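/- Let $N\ge 2$, let $\Omega\subset\mathbb R^N$ be a bounded open set (for instance a bounded domain with $C^{1,1}$ boundary), and let $s\in(0,1)$, $p\in(1,\infty)$ with $ps<N$, $0<\alpha<N$ and $r\in(1,\infty)$. Let $f:\Omega\times\mathbb R\to\mathbb R$ be a Carathéodory function (measurable in $x$ for every $t$, continuous in $t$ for a.e. $x$). Consider the logistic Choquard problem $$(P)\qquad (-\Delta)_p^s u=f(x,u)-\Big(\int_\Omega\frac{|u(y)|^r}{|x-y|^\alpha}\,dy\Big)|u|^{r-2}u\ \text{ in }\Omega,\qquad u=0\ \text{ in }\mathbb R^N\setminus\Omega .$$ Let $W_0^{s,p}(\Omega)$ be the set of $u\in L^p(\mathbb R^N)$ with $\iint_{\mathbb R^{2N}}\frac{|u(x)-u(y)|^p}{|x-y|^{N+ps}}\,dx\,dy<\infty$ and $u=0$ a.e. in $\mathbb R^N\setminus\Omega$, let $W_0^{s,p}(\Omega)_+$ be its cone of functions that are nonnegative a.e., and put $$\langle(-\Delta)_p^su,v\rangle=\iint_{\mathbb R^{2N}}\frac{|u(x)-u(y)|^{p-2}(u(x)-u(y))(v(x)-v(y))}{|x-y|^{N+ps}}\,dx\,dy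 .$$ In the following definitions all integrals are required to converge absolutely. * $\bar u\in W_0^{s,p}(\Omega)$ is a *strong supersolution* of $(P)$ if $\langle(-\Delta)_p^s\bar u,v\rangle\ge\int_\Omega f(x,\bar u)v\,dx$ for all $v\in W_0^{s,p}(\Omega)_+$. * $\underline u\in W_0^{s,p}(\Omega)$ is a *uniform subsolution relative to* $\bar u$ if $\underline u\le\bar u$ a.e. in $\Omega$ and, for all $v\in W_0^{s,p}(\Omega)_+$, $$\langle(-\Delta)_p^s\underline u,v\rangle\le\int_\Omega f(x,\underline u)v\,dx-\int_\Omega\int_\Omega\frac{|\bar u(y)|^r|\underline u(x)|^{r-2}\underline u(x)v(x)}{|x-y|^\alpha}\,dx\,dy .$$ * $u\in W_0^{s,p}(\Omega)$ is a *weak solution* of $(P)$ if it is both a weak supersolution and a weak subsolution, that is, for all $v\in W_0^{s,p}(\Omega)_+$, both $\ge$ and $\le$ hold between $\langle(-\Delta)_p^su,v\rangle$ and $$\int_\Omega f(x,u)v\,dx-\int_\Omega\int_\Omega\frac{|u(y)|^r|u(x)|^{r-2}u(x)v(x)}{|x-y|^\alpha}\,dx\,dy .$$ **Theorem.** Let $\bar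 u$ be a strong supersolution of $(P)$ and $\underline u$ a uniform subsolution relative to $\bar u$ with $0\le\underline u\le\bar u$ a.e. in $\Omega$. Assume that $f(\cdot,w)v\in L^1(\Omega)$ for every measurable $w$ with $\underline u\le w\le\bar u$ a.e. in $\Omega$ and every $v\in W_0^{s,p}(\Omega)$. Then $(P)$ has a weak solution $u\in W_0^{s,p}(\Omega)$ with $u\ge0$ a.e. and $\underline u\le u\le\bar u$ a.e. in $\Omega$. -/

import Mathlib

open MeasureTheory

noncomputable section

namespace LogisticChoquard

/-- The space `ℝ^N` with its Euclidean norm and Lebesgue measure. -/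
abbrev RN (N : ℕ) : Type := EuclideanSpace ℝ (Fin N)

/-- The signed power `t^m = |t|^(m-1) t` for `m > 0` (it vanishes at `t = 0`). -/
def spow (t m : ℝ) : ℝ := |t| ^ (m - 1) * t

/-- Membership in `W_0^{s,p}(Ω)`: `u` is in `L^p(ℝ^N)`, its Gagliardo double integral is finite, and
`u = 0` almost everywhere outside `Ω`. -/
structure MemW0 {N : ℕ} (Ω : Set (RN N)) (s p : ℝ) (u : RN N → ℝ) : Prop where
  memLp : MemLp u (ENNReal.ofReal p) volume
  gagliardo : Integrable
    (fun z : RN N × RN N => |u z.1 - u z.2| ^ p / ‖z.1 - z.2‖ ^ ((N : ℝ) + p * s)) volume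
  eq_zero : ∀ᵐ x ∂(volume : Measure (RN N)), x ∉ Ω → u x = 0

/-- The nonnegative cone of `W_0^{s,p}(Ω)`. -/
def MemW0Pos {N : ℕ} (Ω : Set (RN N)) (s p : ℝ) (v : RN N → ℝ) : Prop :=
  MemW0 Ω s p v ∧ ∀ᵐ x ∂(volume : Measure (RN N)), 0 ≤ v x

/-- The duality pairing `⟨(-Δ)_p^s u, v⟩`. -/
def fracPLap {N : ℕ} (s p : ℝ) (u v : RN N → ℝ) : ℝ :=
  ∫ z : RN N × RN N,
    spow (u z.1 - u z.2) (p - 1) * (v z.1 - v z.2) / ‖z.1 - z.2‖ ^ ((N : ℝ) + p * s)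

/-- The integrand `|a(y)|^r |u(x)|^(r-2) u(x) v(x) / |x-y|^α` at `z = (x, y)`. -/
def choquardIntegrand {N : ℕ} (α r : ℝ) (a u v : RN N → ℝ) (z : RN N × RN N) : ℝ :=
  |a z.2| ^ r * spow (u z.1) (r - 1) * v z.1 / ‖z.1 - z.2‖ ^ α

/-- The Choquard term `∫_Ω ∫_Ω |a(y)|^r |u(x)|^(r-2) u(x) v(x) / |x-y|^α dx dy`. -/
def choquard {N : ℕ} (Ω : Set (RN N)) (α r : ℝ) (a u v : RN N → ℝ) : ℝ :=
  ∫ z in Ω ×ˢ Ω, choquardIntegrand α r a u v z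

/-- Absolute convergence of the integral that defines the Choquard term. -/
def ChoquardIntegrable {N : ℕ} (Ω : Set (RN N)) (α r : ℝ) (a u v : RN N → ℝ) : Prop :=
  IntegrableOn (choquardIntegrand α r a u v) (Ω ×ˢ Ω) volume

/-- `f : Ω × ℝ → ℝ` is a Carathéodory function: (Lebesgue) measurable in `x ∈ Ω` for each `t`,
continuous in `t` for almost every `x ∈ Ω`. Values of `f x` for `x ∉ Ω` are never used. -/
def Caratheodory {N : ℕ} (Ω : Set (RN N)) (f : RN N → ℝ → ℝ) : Prop :=
  (∀ t : ℝ, AEMeasurable (fun x => f x t) (volume.restrict Ω)) ∧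
    ∀ᵐ x ∂(volume.restrict Ω), Continuous (f x)

/-- Weak supersolution of
`(-Δ)_p^s u = f(x,u) - (∫_Ω |u(y)|^r / |x-y|^α dy) |u|^(r-2) u` in `Ω`, `u = 0` outside `Ω`.
All the integrals of the weak formulation are required to converge absolutely. -/
structure WeakSupersolution {N : ℕ} (Ω : Set (RN N)) (s p α r : ℝ) (f : RN N → ℝ → ℝ)
    (u : RN N → ℝ) : Prop where
  memW0 : MemW0 Ω s p u
  nonneg_outside : ∀ᵐ x ∂(volume : Measure (RN N)), x ∉ Ω → 0 ≤ u x
  ineq : ∀ v : RN N → ℝ, MemW0Pos Ω s p v →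
    IntegrableOn (fun x => f x (u x) * v x) Ω volume ∧
    ChoquardIntegrable Ω α r u u v ∧
    fracPLap s p u v ≥ (∫ x in Ω, f x (u x) * v x) - choquard Ω α r u u v

/-- Weak subsolution of the same problem. -/
structure WeakSubsolution {N : ℕ} (Ω : Set (RN N)) (s p α r : ℝ) (f : RN N → ℝ → ℝ)
    (u : RN N → ℝ) : Prop where
  memW0 : MemW0 Ω s p u
  nonpos_outside : ∀ᵐ x ∂(volume : Measure (RN N)), x ∉ Ω → u x ≤ 0
  ineq : ∀ v : RN N → ℝ, MemW0Pos Ω s p v →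
    IntegrableOn (fun x => f x (u x) * v x) Ω volume ∧
    ChoquardIntegrable Ω α r u u v ∧
    fracPLap s p u v ≤ (∫ x in Ω, f x (u x) * v x) - choquard Ω α r u u v

/-- Weak solution: both a weak supersolution and a weak subsolution. -/
def WeakSolution {N : ℕ} (Ω : Set (RN N)) (s p α r : ℝ) (f : RN N → ℝ → ℝ)
    (u : RN N → ℝ) : Prop :=
  WeakSupersolution Ω s p α r f u ∧ WeakSubsolution Ω s p α r f u

/-- Strong supersolution: a supersolution of the problem without its Choquard term. -/
structure StrongSupersolution {N : ℕ} (Ω : Set (RN N)) (s p : ℝ) (f : RN N → ℝ → ℝ)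
    (uU : RN N → ℝ) : Prop where
  memW0 : MemW0 Ω s p uU
  nonneg_outside : ∀ᵐ x ∂(volume : Measure (RN N)), x ∉ Ω → 0 ≤ uU x
  ineq : ∀ v : RN N → ℝ, MemW0Pos Ω s p v →
    IntegrableOn (fun x => f x (uU x) * v x) Ω volume ∧
    fracPLap s p uU v ≥ ∫ x in Ω, f x (uU x) * v x

/-- Uniform subsolution `uL` relative to the strong supersolution `uU`: the nonlocal coefficient of
the Choquard term is computed from `uU`. -/
structure UniformSubsolution {N : ℕ} (Ω : Set (RN N)) (s p α r : ℝ) (f : RN N → ℝ → ℝ)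
    (uU uL : RN N → ℝ) : Prop where
  memW0 : MemW0 Ω s p uL
  nonpos_outside : ∀ᵐ x ∂(volume : Measure (RN N)), x ∉ Ω → uL x ≤ 0
  le : ∀ᵐ x ∂(volume.restrict Ω), uL x ≤ uU x
  ineq : ∀ v : RN N → ℝ, MemW0Pos Ω s p v →
    IntegrableOn (fun x => f x (uL x) * v x) Ω volume ∧
    ChoquardIntegrable Ω α r uU uL v ∧
    fracPLap s p uL v ≤ (∫ x in Ω, f x (uL x) * v x) - choquard Ω α r uU uL v

/-- The reaction term of the weak formulation makes sense on the order interval `[uL, uU]`: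
for every measurable `w` between `uL` and `uU` and every `v ∈ W_0^{s,p}(Ω)`, the integral
`∫_Ω f(x,w) v dx` converges absolutely. -/
def ReactionIntegrable {N : ℕ} (Ω : Set (RN N)) (s p : ℝ) (f : RN N → ℝ → ℝ)
    (uL uU : RN N → ℝ) : Prop :=
  ∀ w : RN N → ℝ, AEMeasurable w (volume.restrict Ω) →
    (∀ᵐ x ∂(volume.restrict Ω), uL x ≤ w x ∧ w x ≤ uU x) →
    ∀ v : RN N → ℝ, MemW0 Ω s p v → IntegrableOn (fun x => f x (w x) * v x) Ω volume

end LogisticChoquard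

end

/-!
The problem is variational: its weak solutions are critical points of
`[u]^p / p + (2r)⁻¹ ∬ |u(x)|^r |u(y)|^r / |x-y|^α - ∫ F(x, u)`, where `F` is the primitive of `f`.
The solution is a minimiser of this energy over the order interval between `uL` and `uU`.

* On the order interval `|f|` is dominated by a weight `H` with `H v` integrable for every `v` in
  `W_0^{s,p}(Ω)`: a measurable selection `w` attains half the supremum of `|f(x, ·)|`
  (`exists_measurable_half_max`), and the integrability hypothesis applies to it. After truncation
  of `f` to the order interval and addition of a constant, the energy is a sum of three integrals of
  nonnegative functions, so it is lower semicontinuous along almost everywhere convergence by Fatou's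
  lemma (`energy_le_liminf`). It is finite at `uL` because `uL` is a uniform subsolution.
* A minimising sequence has bounded Gagliardo energy, hence a subsequence that converges almost
  everywhere (`exists_subseq_tendsto_ae`). This gives a minimiser (`exists_energy_minimizer`).
* Differentiation of the energy along bounded admissible directions gives a variational inequality
  (`variational_inequality`). Boundedness matters: `r` may be supercritical, and only for bounded `v`
  is the Choquard term known in advance to converge.
* For a bounded `φ ≥ 0`, the direction `φ - (φ - n (uU - u))⁺` is admissible. The remaining cut-off
  concentrates on the contact set `{u = uU}` as `n → ∞`; there the supersolution property of `uU` and
  the asymptotic comparison of the nonlocal operators (`exists_tendsto_fracPLap_cut`) show that `u`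
  is a supersolution (`EnergyMinimizer.super`). The argument at `uL` is symmetric
  (`EnergyMinimizer.sub`) and uses that the coefficient computed from `uU` exceeds the one computed
  from `u`.
* Unbounded test functions are approximated by `min v n`. The Choquard integrands are nonnegative, so
  the equation itself bounds their integrals, and Fatou's lemma gives absolute convergence
  (`EnergyMinimizer.equation`).
-/

noncomputable section

namespace LogisticChoquard

open Filter Topology

/-! ### Signed powers -/

section SignedPower

lemma measurable_spow (m : ℝ) : Measurable fun t => spow t m := by
  unfold spow; fun_prop

lemma abs_spow {m : ℝ} (hm : 0 < m) (t : ℝ) : |spow t m| = |t| ^ m := by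
  unfold spow
  rw [abs_mul, abs_of_nonneg (Real.rpow_nonneg (abs_nonneg t) _)]
  rcases eq_or_ne t 0 with rfl | ht
  · simp [Real.zero_rpow hm.ne']
  · rw [← Real.rpow_add_one (abs_pos.2 ht).ne']; simp

lemma spow_of_nonneg {m : ℝ} (hm : 0 < m) {t : ℝ} (ht : 0 ≤ t) : spow t m = t ^ m := by
  have h := abs_spow hm t
  rwa [abs_of_nonneg ht, abs_of_nonneg] at h
  unfold spow
  positivity

lemma spow_of_nonpos {m : ℝ} (hm : 0 < m) {t : ℝ} (ht : t ≤ 0) : spow t m = -(-t) ^ m := by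
  rw [← spow_of_nonneg hm (neg_nonneg.2 ht)]
  unfold spow
  rw [abs_neg]; ring

lemma spow_mono {m : ℝ} (hm : 0 < m) : Monotone fun t => spow t m := by
  intro a b hab
  simp only
  rcases le_total 0 a with ha | ha
  · rw [spow_of_nonneg hm ha, spow_of_nonneg hm (ha.trans hab)]
    exact Real.rpow_le_rpow ha hab hm.le
  · rcases le_total 0 b with hb | hb
    · rw [spow_of_nonpos hm ha, spow_of_nonneg hm hb]
      have := Real.rpow_nonneg (neg_nonneg.2 ha) m
      have := Real.rpow_nonneg hb m
      linarith
    · rw [spow_of_nonpos hm ha, spow_of_nonpos hm hb]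
      exact neg_le_neg (Real.rpow_le_rpow (neg_nonneg.2 hb) (neg_le_neg hab) hm.le)

lemma hasDerivAt_abs_rpow_add_mul {q : ℝ} (hq : 1 < q) (a b t : ℝ) :
    HasDerivAt (fun t => |a + t * b| ^ q) (q * spow (a + t * b) (q - 1) * b) t := by
  have h1 : HasDerivAt (fun t => a + t * b) b t := by
    simpa using ((hasDerivAt_id t).mul_const b).const_add a
  have h2 := (hasDerivAt_abs_rpow (a + t * b) hq).comp t h1
  have h3 : spow (a + t * b) (q - 1) = |a + t * b| ^ (q - 2) * (a + t * b) := by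
    unfold spow
    rw [show q - 1 - 1 = q - 2 by ring]
  rw [h3, ← mul_assoc q]
  exact h2

lemma rpow_add_le_two_rpow_mul {q : ℝ} (hq : 0 ≤ q) {a b : ℝ} (ha : 0 ≤ a) (hb : 0 ≤ b) :
    (a + b) ^ q ≤ 2 ^ q * (a ^ q + b ^ q) := by
  have h : a + b ≤ 2 * max a b := by
    have := le_max_left a b
    have := le_max_right a b
    linarith
  calc (a + b) ^ q ≤ (2 * max a b) ^ q := Real.rpow_le_rpow (by positivity) h hq
    _ = 2 ^ q * (max a b) ^ q := Real.mul_rpow (by norm_num) (by positivity)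
    _ ≤ 2 ^ q * (a ^ q + b ^ q) := by
      gcongr
      rcases max_choice a b with h | h <;> rw [h]
      · linarith [Real.rpow_nonneg hb q]
      · linarith [Real.rpow_nonneg ha q]

lemma abs_spow_mul_le {q : ℝ} (hq : 1 < q) {a b c : ℝ} (ha : |a| ≤ c) (hb : |b| ≤ c) :
    |spow a (q - 1) * b| ≤ c ^ q := by
  have hc : 0 ≤ c := (abs_nonneg a).trans ha
  rw [abs_mul, abs_spow (by linarith)]
  calc |a| ^ (q - 1) * |b| ≤ c ^ (q - 1) * c := by
        gcongr
    _ = c ^ q := by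
        rcases hc.eq_or_lt with rfl | hc
        · rw [mul_zero, Real.zero_rpow (by linarith)]
        · rw [← Real.rpow_add_one hc.ne']; simp

lemma abs_spow_mul_le_add {q : ℝ} (hq : 1 < q) (a b : ℝ) :
    |spow a (q - 1) * b| ≤ 2 ^ q * (|a| ^ q + |b| ^ q) :=
  (abs_spow_mul_le hq (c := |a| + |b|) (by linarith [abs_nonneg b])
    (by linarith [abs_nonneg a])).trans
    (rpow_add_le_two_rpow_mul (by linarith) (abs_nonneg _) (abs_nonneg _))

end SignedPower

/-! ### The space `W_0^{s,p}(Ω)` and its pairing -/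

section Space

variable {N : ℕ} {Ω : Set (RN N)} {s p : ℝ} {u v w : RN N → ℝ}

lemma ae_prod_of_ae {P : RN N → Prop} (h : ∀ᵐ x ∂(volume : Measure (RN N)), P x) :
    ∀ᵐ z ∂(volume : Measure (RN N × RN N)), P z.1 ∧ P z.2 :=
  (Measure.quasiMeasurePreserving_fst.ae h).and (Measure.quasiMeasurePreserving_snd.ae h)

lemma aemeasurable_fst (hu : AEMeasurable u volume) :
    AEMeasurable (fun z : RN N × RN N => u z.1) volume := AEMeasurable.comp_fst hu

lemma aemeasurable_snd (hu : AEMeasurable u volume) :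
    AEMeasurable (fun z : RN N × RN N => u z.2) volume := AEMeasurable.comp_snd hu

lemma aemeasurable_diff (hu : AEMeasurable u volume) :
    AEMeasurable (fun z : RN N × RN N => u z.1 - u z.2) volume :=
  (aemeasurable_fst hu).sub (aemeasurable_snd hu)

lemma aemeasurable_gagliardo (hu : AEMeasurable u volume) :
    AEMeasurable (fun z : RN N × RN N =>
      |u z.1 - u z.2| ^ p / ‖z.1 - z.2‖ ^ ((N : ℝ) + p * s)) volume := by
  have h := aemeasurable_diff hu
  have h1 : AEMeasurable (fun z : RN N × RN N => |u z.1 - u z.2| ^ p) volume :=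
    (measurable_norm.comp_aemeasurable h).pow_const p
  exact h1.div (by fun_prop)

lemma aemeasurable_fracPLap (hu : AEMeasurable u volume) (hv : AEMeasurable v volume) :
    AEMeasurable (fun z : RN N × RN N =>
      spow (u z.1 - u z.2) (p - 1) * (v z.1 - v z.2) / ‖z.1 - z.2‖ ^ ((N : ℝ) + p * s)) volume :=
  (((measurable_spow _).comp_aemeasurable (aemeasurable_diff hu)).mul
    (aemeasurable_diff hv)).div (by fun_prop)

lemma MemW0.aemeasurable (hu : MemW0 Ω s p u) : AEMeasurable u volume :=
  hu.memLp.aestronglyMeasurable.aemeasurable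

/-- Functions controlled, together with their increments, by two elements of `W_0^{s,p}(Ω)` belong
to `W_0^{s,p}(Ω)`. -/
lemma MemW0.of_le (hp : 1 < p) (hu : MemW0 Ω s p u) (hv : MemW0 Ω s p v)
    (hw : AEMeasurable w volume) (h1 : ∀ x, |w x| ≤ |u x| + |v x|)
    (h2 : ∀ x y, |w x - w y| ≤ |u x - u y| + |v x - v y|) : MemW0 Ω s p w where
  memLp := by
    refine (hu.memLp.norm.add hv.memLp.norm).mono hw.aestronglyMeasurable (ae_of_all _ fun x => ?_)
    simp only [Pi.add_apply, Real.norm_eq_abs]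
    rw [abs_of_nonneg (add_nonneg (abs_nonneg (u x)) (abs_nonneg (v x)))]
    exact h1 x
  gagliardo := by
    refine ((hu.gagliardo.add hv.gagliardo).const_mul (2 ^ p)).mono'
      (aemeasurable_gagliardo hw).aestronglyMeasurable (ae_of_all _ fun z => ?_)
    rw [Real.norm_of_nonneg (by positivity)]
    simp only [Pi.add_apply]
    rw [← add_div, ← mul_div_assoc]
    gcongr
    exact (Real.rpow_le_rpow (abs_nonneg _) (h2 _ _) (by linarith)).trans
      (rpow_add_le_two_rpow_mul (by linarith) (abs_nonneg _) (abs_nonneg _))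
  eq_zero := by
    filter_upwards [hu.eq_zero, hv.eq_zero] with x hx hy hxΩ
    have := h1 x
    rw [hx hxΩ, hy hxΩ] at this
    simpa using this

lemma MemW0.add (hp : 1 < p) (hu : MemW0 Ω s p u) (hv : MemW0 Ω s p v) :
    MemW0 Ω s p (fun x => u x + v x) :=
  hu.of_le hp hv (hu.aemeasurable.add hv.aemeasurable) (fun _ => abs_add_le _ _) fun x y => by
    rw [add_sub_add_comm]; exact abs_add_le _ _

lemma MemW0.sub (hp : 1 < p) (hu : MemW0 Ω s p u) (hv : MemW0 Ω s p v) :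
    MemW0 Ω s p (fun x => u x - v x) :=
  hu.of_le hp hv (hu.aemeasurable.sub hv.aemeasurable) (fun _ => abs_sub _ _) fun x y => by
    rw [sub_sub_sub_comm]; exact abs_sub _ _

lemma MemW0.const_mul (c : ℝ) (hu : MemW0 Ω s p u) :
    MemW0 Ω s p (fun x => c * u x) where
  memLp := hu.memLp.const_mul c
  gagliardo := by
    refine (hu.gagliardo.const_mul (|c| ^ p)).congr (ae_of_all _ fun z => ?_)
    simp only
    rw [← mul_sub, abs_mul, Real.mul_rpow (abs_nonneg _) (abs_nonneg _), mul_div_assoc]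
  eq_zero := by
    filter_upwards [hu.eq_zero] with x hx hxΩ
    rw [hx hxΩ, mul_zero]

lemma integrable_fracPLap (hp : 1 < p) (hu : MemW0 Ω s p u) (hv : MemW0 Ω s p v) :
    Integrable (fun z : RN N × RN N =>
      spow (u z.1 - u z.2) (p - 1) * (v z.1 - v z.2) / ‖z.1 - z.2‖ ^ ((N : ℝ) + p * s)) volume := by
  refine ((hu.gagliardo.add hv.gagliardo).const_mul (2 ^ p)).mono'
    (aemeasurable_fracPLap hu.aemeasurable hv.aemeasurable).aestronglyMeasurable
    (ae_of_all _ fun z => ?_)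
  rw [Real.norm_eq_abs, abs_div, abs_of_nonneg (Real.rpow_nonneg (norm_nonneg (z.1 - z.2)) _)]
  simp only [Pi.add_apply]
  rw [← add_div, ← mul_div_assoc]
  gcongr
  exact abs_spow_mul_le_add hp _ _

lemma fracPLap_sub (hp : 1 < p) (hu : MemW0 Ω s p u) (hv : MemW0 Ω s p v) (hw : MemW0 Ω s p w) :
    fracPLap s p u (fun x => v x - w x) = fracPLap s p u v - fracPLap s p u w := by
  unfold fracPLap
  rw [← integral_sub (integrable_fracPLap hp hu hv) (integrable_fracPLap hp hu hw)]
  congr 1; ext z; ring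

lemma fracPLap_const_mul (c : ℝ) :
    fracPLap s p u (fun x => c * v x) = c * fracPLap s p u v := by
  unfold fracPLap
  rw [← integral_const_mul]
  congr 1; ext z; ring

end Space

/-! ### Comparison along the contact set -/

section Contact

/-- The truncation `(φ - n e)⁺`. With `e` the gap between two ordered functions, it converges, as
`n → ∞`, to `φ` on the contact set `{e = 0}` and to `0` elsewhere. -/
def cut {X : Type*} (φ e : X → ℝ) (n : ℕ) (x : X) : ℝ := max (φ x - n * e x) 0

variable {X : Type*} {φ e : X → ℝ}

lemma cut_nonneg (n : ℕ) (x : X) : 0 ≤ cut φ e n x := le_max_right _ _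

lemma cut_le {n : ℕ} {x : X} (hφ : 0 ≤ φ x) (he : 0 ≤ e x) : cut φ e n x ≤ φ x :=
  max_le (by have : 0 ≤ (n : ℝ) * e x := by positivity
             linarith) hφ

lemma sub_cut_eq_min (n : ℕ) (x : X) : φ x - cut φ e n x = min (φ x) (n * e x) := by
  unfold cut
  rcases le_total (φ x - n * e x) 0 with h | h
  · rw [max_eq_right h, min_eq_left (by linarith)]; ring
  · rw [max_eq_left h, min_eq_right (by linarith)]; ring

lemma eventually_cut_eq_zero {x : X} (he : 0 < e x) : ∀ᶠ n : ℕ in atTop, cut φ e n x = 0 := by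
  obtain ⟨n₀, hn₀⟩ := exists_nat_ge (φ x / e x)
  filter_upwards [eventually_ge_atTop n₀] with n hn
  have h1 : φ x / e x ≤ n := hn₀.trans (by exact_mod_cast hn)
  rw [div_le_iff₀ he] at h1
  exact max_eq_right (by linarith)

lemma abs_cut_le (n : ℕ) (x : X) : |cut φ e n x| ≤ |φ x| + |n * e x| := by
  rw [abs_of_nonneg (cut_nonneg n x)]
  refine max_le ?_ (by positivity)
  linarith [le_abs_self (φ x), neg_abs_le ((n : ℝ) * e x)]

lemma abs_cut_sub_cut_le (n : ℕ) (x y : X) :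
    |cut φ e n x - cut φ e n y| ≤ |φ x - φ y| + |n * e x - n * e y| := by
  refine (abs_max_sub_max_le_abs _ _ _).trans ?_
  rw [sub_sub_sub_comm]
  exact abs_sub _ _

/-- If `e x ≤ e y`, then the increment of `(φ - n e)⁺` from `y` to `x` cannot be more negative than
that of `φ`. -/
lemma neg_abs_le_cut_sub_cut {n : ℕ} {x y : X} (h : e x ≤ e y) :
    -|φ x - φ y| ≤ cut φ e n x - cut φ e n y := by
  have h1 : (n : ℝ) * e x ≤ n * e y := by gcongr
  have h2 : cut φ e n y ≤ cut φ e n x + |φ x - φ y| := by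
    refine max_le ?_ (add_nonneg (cut_nonneg n x) (abs_nonneg _))
    have h3 : φ x - n * e x ≤ cut φ e n x := le_max_left _ _
    linarith [neg_abs_le (φ x - φ y)]
  linarith

lemma mul_cut_sub_cut_ge {m : ℝ} (hm : 0 < m) {u₁ u₂ : X → ℝ} (n : ℕ) (x y : X) :
    -|(spow (u₁ x - u₁ y) m - spow (u₂ x - u₂ y) m) * (φ x - φ y)| ≤
    (spow (u₁ x - u₁ y) m - spow (u₂ x - u₂ y) m) *
      (cut φ (fun x => u₂ x - u₁ x) n x - cut φ (fun x => u₂ x - u₁ x) n y) := by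
  set D := spow (u₁ x - u₁ y) m - spow (u₂ x - u₂ y) m with hD
  rw [abs_mul]
  rcases le_total (u₂ x - u₁ x) (u₂ y - u₁ y) with h | h
  · have hD0 : 0 ≤ D := sub_nonneg.2 (spow_mono hm (by linarith))
    have := neg_abs_le_cut_sub_cut (φ := φ) (e := fun x => u₂ x - u₁ x) (n := n) h
    rw [abs_of_nonneg hD0]
    nlinarith
  · have hD0 : D ≤ 0 := sub_nonpos.2 (spow_mono hm (by linarith))
    have := neg_abs_le_cut_sub_cut (φ := φ) (e := fun x => u₂ x - u₁ x) (n := n) h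
    rw [abs_sub_comm (φ y)] at this
    rw [abs_of_nonpos hD0]
    nlinarith

lemma eventually_mul_cut_sub_cut_nonneg {m : ℝ} (hm : 0 < m) {u₁ u₂ : X → ℝ} {x y : X}
    (hx : u₁ x ≤ u₂ x) (hy : u₁ y ≤ u₂ y) :
    ∀ᶠ n : ℕ in atTop, 0 ≤ (spow (u₁ x - u₁ y) m - spow (u₂ x - u₂ y) m) *
      (cut φ (fun x => u₂ x - u₁ x) n x - cut φ (fun x => u₂ x - u₁ x) n y) := by
  set e := fun x => u₂ x - u₁ x with he
  rcases hx.eq_or_lt with hx' | hx' <;> rcases hy.eq_or_lt with hy' | hy'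
  · rw [hx', hy']; simp
  · filter_upwards [eventually_cut_eq_zero (φ := φ) (e := e) (sub_pos.2 hy')] with n hn
    rw [hn, sub_zero]
    exact mul_nonneg (sub_nonneg.2 (spow_mono hm (by linarith))) (cut_nonneg n x)
  · filter_upwards [eventually_cut_eq_zero (φ := φ) (e := e) (sub_pos.2 hx')] with n hn
    rw [hn, zero_sub]
    exact mul_nonneg_of_nonpos_of_nonpos (sub_nonpos.2 (spow_mono hm (by linarith)))
      (neg_nonpos.2 (cut_nonneg n y))
  · filter_upwards [eventually_cut_eq_zero (φ := φ) (e := e) (sub_pos.2 hx'),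
      eventually_cut_eq_zero (φ := φ) (e := e) (sub_pos.2 hy')] with n hn hn'
    rw [hn, hn']; simp

variable {N : ℕ} {Ω : Set (RN N)} {s p : ℝ} {u₁ u₂ φ : RN N → ℝ}

lemma MemW0.cut (hp : 1 < p) {e : RN N → ℝ} (hφ : MemW0 Ω s p φ) (he : MemW0 Ω s p e) (n : ℕ) :
    MemW0 Ω s p (cut φ e n) :=
  hφ.of_le hp (he.const_mul (n : ℝ))
    ((hφ.aemeasurable.sub (he.aemeasurable.const_mul _)).max aemeasurable_const)
    (abs_cut_le n) (abs_cut_sub_cut_le n)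

/-- For ordered functions `u₁ ≤ u₂`, tested with the cut-offs `(φ - n (u₂ - u₁))⁺` that concentrate
on the contact set, the operator applied to `u₁` is asymptotically at least the operator applied
to `u₂`. Nonlocality enters only through pairs with one point on the contact set and one off it,
and there the monotonicity of the signed power gives the integrand the favourable sign. -/
lemma exists_tendsto_fracPLap_cut (hp : 1 < p) (h₁ : MemW0 Ω s p u₁) (h₂ : MemW0 Ω s p u₂)
    (hle : ∀ᵐ x ∂(volume : Measure (RN N)), u₁ x ≤ u₂ x) (hφ : MemW0 Ω s p φ) :
    ∃ R : ℕ → ℝ, Tendsto R atTop (𝓝 0) ∧ ∀ n,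
      fracPLap s p u₂ (LogisticChoquard.cut φ (fun x => u₂ x - u₁ x) n) + R n ≤
        fracPLap s p u₁ (LogisticChoquard.cut φ (fun x => u₂ x - u₁ x) n) := by
  set χ := LogisticChoquard.cut φ (fun x => u₂ x - u₁ x) with hχ
  have hχW : ∀ n, MemW0 Ω s p (χ n) := fun n => hφ.cut hp (h₂.sub hp h₁) n
  let k : RN N × RN N → ℝ := fun z => ‖z.1 - z.2‖ ^ ((N : ℝ) + p * s)
  have hk : ∀ z, 0 ≤ k z := fun z => by positivity
  let F : ℕ → RN N × RN N → ℝ := fun n z =>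
    (spow (u₁ z.1 - u₁ z.2) (p - 1) - spow (u₂ z.1 - u₂ z.2) (p - 1)) * (χ n z.1 - χ n z.2) / k z
  have hFint : ∀ n, Integrable (F n) volume := fun n => by
    refine ((integrable_fracPLap hp h₁ (hχW n)).sub (integrable_fracPLap hp h₂ (hχW n))).congr
      (ae_of_all _ fun z => ?_)
    simp only [Pi.sub_apply, F, k]; ring
  have hFeq : ∀ n, ∫ z, F n z = fracPLap s p u₁ (χ n) - fracPLap s p u₂ (χ n) := fun n => by
    unfold fracPLap
    rw [← integral_sub (integrable_fracPLap hp h₁ (hχW n)) (integrable_fracPLap hp h₂ (hχW n))]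
    congr 1; ext z; simp only [F, k]; ring
  have hB : Integrable (fun z : RN N × RN N =>
      |(spow (u₁ z.1 - u₁ z.2) (p - 1) - spow (u₂ z.1 - u₂ z.2) (p - 1)) * (φ z.1 - φ z.2)| / k z)
      volume := by
    refine ((integrable_fracPLap hp h₁ hφ).sub (integrable_fracPLap hp h₂ hφ)).abs.congr
      (ae_of_all _ fun z => ?_)
    simp only [Pi.sub_apply]
    rw [← sub_div, ← sub_mul, abs_div, abs_of_nonneg (hk z)]
  refine ⟨fun n => ∫ z, min (F n z) 0, ?_, fun n => ?_⟩
  · suffices h : Tendsto (fun n => ∫ z, min (F n z) 0) atTop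
        (𝓝 (∫ _ : RN N × RN N, (0 : ℝ))) by simpa using h
    refine tendsto_integral_of_dominated_convergence _
      (fun n => ((hFint n).aestronglyMeasurable.aemeasurable.min
        aemeasurable_const).aestronglyMeasurable) hB
      (fun n => ae_of_all _ fun z => ?_) ?_
    · rw [Real.norm_eq_abs, abs_of_nonpos (min_le_right _ _), neg_le]
      refine le_min ?_ (neg_nonpos.2 (by positivity))
      rw [← neg_div]
      exact div_le_div_of_nonneg_right (mul_cut_sub_cut_ge (by linarith) n _ _) (hk z)
    · filter_upwards [ae_prod_of_ae hle] with z hz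
      refine tendsto_const_nhds.congr' ?_
      filter_upwards [eventually_mul_cut_sub_cut_nonneg (m := p - 1) (by linarith) hz.1
        hz.2] with n hn
      exact (min_eq_right (div_nonneg hn (hk z))).symm
  · have : ∫ z, min (F n z) 0 ≤ ∫ z, F n z :=
      integral_mono ((hFint n).inf (integrable_zero _ _ _)) (hFint n) fun z => min_le_left _ _
    rw [hFeq] at this
    linarith

end Contact

/-! ### Compactness: bounded Gagliardo energy yields almost everywhere convergence -/

section Compactness

open scoped ENNReal

variable {N : ℕ} {Ω : Set (RN N)} {s p : ℝ}

lemma le_add_mul_rpow (hp : 1 < p) {l t : ℝ} (hl : 0 < l) (ht : 0 ≤ t) :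
    t ≤ l + l ^ (1 - p) * t ^ p := by
  rcases le_total t l with h | h
  · have : 0 ≤ l ^ (1 - p) * t ^ p := by positivity
    linarith
  · have ht' : 0 < t := hl.trans_le h
    have h1 : t ^ (1 - p) ≤ l ^ (1 - p) := Real.rpow_le_rpow_of_nonpos hl h (by linarith)
    have h2 : t = t ^ (1 - p) * t ^ p := by
      rw [← Real.rpow_add ht']; simp
    have h3 : t ^ (1 - p) * t ^ p ≤ l ^ (1 - p) * t ^ p := by gcongr
    linarith

lemma enorm_sub_average_le {v : RN N → ℝ} (hv : Integrable v volume) (x c : RN N) {ε : ℝ}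
    (hε : 0 < ε) :
    ‖v x - ⨍ y in Metric.ball c ε, v y‖ₑ ≤
      ∫⁻ y, ‖v x - v y‖ₑ ∂((volume (Metric.ball c ε))⁻¹ • volume.restrict (Metric.ball c ε)) := by
  have hB0 : volume (Metric.ball c ε) ≠ 0 := (Metric.measure_ball_pos volume c hε).ne'
  have hBt : volume (Metric.ball c ε) ≠ ⊤ := measure_ball_lt_top.ne
  have hP : IsProbabilityMeasure
      ((volume (Metric.ball c ε))⁻¹ • volume.restrict (Metric.ball c ε)) := ⟨by
    simp [ENNReal.inv_mul_cancel hB0 hBt]⟩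
  have hvi : Integrable v ((volume (Metric.ball c ε))⁻¹ • volume.restrict (Metric.ball c ε)) :=
    hv.restrict.smul_measure (ENNReal.inv_ne_top.2 hB0)
  have : v x - ⨍ y in Metric.ball c ε, v y =
      ∫ y, (v x - v y) ∂((volume (Metric.ball c ε))⁻¹ • volume.restrict (Metric.ball c ε)) := by
    rw [integral_sub (integrable_const _) hvi, average]
    simp
  rw [this]
  exact enorm_integral_le_lintegral_enorm _

/-- The `L¹(Ω)`-distance from a function to its averages over balls of radius `ε` that contain the
point of evaluation is controlled by the Gagliardo energy. -/
lemma lintegral_sub_average_le (hs : 0 < s) (hp : 1 < p) {v : RN N → ℝ}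
    (hv : Integrable v volume) {ε l : ℝ} (hε : 0 < ε) (hl : 0 < l) (c : RN N → RN N)
    (hc : ∀ x, x ∈ Metric.ball (c x) ε) :
    ∫⁻ x in Ω, ‖v x - ⨍ y in Metric.ball (c x) ε, v y‖ₑ ≤
      ENNReal.ofReal l * volume Ω + (volume (Metric.ball (0 : RN N) ε))⁻¹ *
        (ENNReal.ofReal (l ^ (1 - p) * (2 * ε) ^ ((N : ℝ) + p * s)) *
          ∫⁻ z : RN N × RN N, ENNReal.ofReal
            (|v z.1 - v z.2| ^ p / ‖z.1 - z.2‖ ^ ((N : ℝ) + p * s))) := by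
  set K := ENNReal.ofReal (l ^ (1 - p) * (2 * ε) ^ ((N : ℝ) + p * s)) with hK
  set V := volume (Metric.ball (0 : RN N) ε) with hV
  have hVc : ∀ x, volume (Metric.ball x ε) = V := fun x =>
    Measure.addHaar_ball_center volume x ε
  have hV0 : V ≠ 0 := (Metric.measure_ball_pos volume _ hε).ne'
  have hVt : V ≠ ⊤ := measure_ball_lt_top.ne
  have hexp : 0 < (N : ℝ) + p * s := by positivity
  let G : RN N × RN N → ℝ≥0∞ := fun z =>
    ENNReal.ofReal (|v z.1 - v z.2| ^ p / ‖z.1 - z.2‖ ^ ((N : ℝ) + p * s))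
  have hpt : ∀ x, ‖v x - ⨍ y in Metric.ball (c x) ε, v y‖ₑ ≤
      ENNReal.ofReal l + V⁻¹ * (K * ∫⁻ y, G (x, y)) := by
    intro x
    refine (enorm_sub_average_le hv x (c x) hε).trans ?_
    rw [hVc, lintegral_smul_measure, smul_eq_mul]
    have h1 : ∫⁻ y in Metric.ball (c x) ε, ‖v x - v y‖ₑ ≤
        ∫⁻ y in Metric.ball (c x) ε, (ENNReal.ofReal l + K * G (x, y)) := by
      refine setLIntegral_mono' measurableSet_ball fun y hy => ?_
      rw [hK, ← ENNReal.ofReal_mul (by positivity), ← ENNReal.ofReal_add hl.le (by positivity),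
        Real.enorm_eq_ofReal_abs]
      refine ENNReal.ofReal_le_ofReal ((le_add_mul_rpow hp hl (abs_nonneg _)).trans ?_)
      rw [mul_assoc]
      gcongr
      simp only
      have hd : ‖x - y‖ ≤ 2 * ε := by
        have h1 := Metric.mem_ball.1 (hc x)
        have h2 := Metric.mem_ball.1 hy
        rw [← dist_eq_norm]
        linarith [dist_triangle_right x y (c x)]
      rcases eq_or_ne x y with rfl | hxy
      · rw [sub_self, abs_zero, Real.zero_rpow (by linarith)]; simp
      · have hn : 0 < ‖x - y‖ := norm_pos_iff.2 (sub_ne_zero.2 hxy)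
        rw [mul_div_assoc', le_div_iff₀ (by positivity), mul_comm]
        gcongr
    refine (mul_le_mul_right h1 _).trans ?_
    rw [lintegral_add_left measurable_const, lintegral_const_mul' _ _ ENNReal.ofReal_ne_top,
      mul_add, lintegral_const, Measure.restrict_apply_univ, hVc, mul_comm (ENNReal.ofReal l),
      ← mul_assoc, ENNReal.inv_mul_cancel hV0 hVt, one_mul]
    gcongr
    exact Measure.restrict_le_self
  refine (lintegral_mono hpt).trans ?_
  rw [lintegral_add_left measurable_const, lintegral_const, Measure.restrict_apply_univ,
    lintegral_const_mul' _ _ (ENNReal.inv_ne_top.2 hV0),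
    lintegral_const_mul' _ _ ENNReal.ofReal_ne_top]
  gcongr
  have hG : AEMeasurable G ((volume : Measure (RN N)).prod volume) :=
    (aemeasurable_gagliardo hv.aestronglyMeasurable.aemeasurable).ennreal_ofReal
  calc ∫⁻ x in Ω, ∫⁻ y, G (x, y) ≤ ∫⁻ x, ∫⁻ y, G (x, y) :=
        lintegral_mono' Measure.restrict_le_self le_rfl
    _ = ∫⁻ z, G z ∂((volume : Measure (RN N)).prod volume) := (lintegral_prod _ hG).symm

lemma exists_radius_bound (hs : 0 < s) (hp : 1 < p) (hΩ : volume Ω ≠ ⊤) (C : ℝ) {η : ℝ≥0∞}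
    (hη : 0 < η) :
    ∃ l : ℝ, 0 < l ∧ ∃ j : ℕ, ENNReal.ofReal l * volume Ω +
      (volume (Metric.ball (0 : RN N) (1 / ((j : ℝ) + 1))))⁻¹ *
        (ENNReal.ofReal (l ^ (1 - p) * (2 * (1 / ((j : ℝ) + 1))) ^ ((N : ℝ) + p * s)) *
          ENNReal.ofReal C) ≤ η := by
  have hη2 : 0 < η / 2 := ENNReal.half_pos hη.ne'
  obtain ⟨l, hl, hlη⟩ : ∃ l : ℝ, 0 < l ∧ ENNReal.ofReal l * volume Ω ≤ η / 2 := by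
    have ht : Tendsto (fun j : ℕ => ENNReal.ofReal (1 / ((j : ℝ) + 1)) * volume Ω) atTop
        (𝓝 (ENNReal.ofReal 0 * volume Ω)) :=
      ENNReal.Tendsto.mul_const (ENNReal.tendsto_ofReal tendsto_one_div_add_atTop_nhds_zero_nat)
        (Or.inr hΩ)
    rw [ENNReal.ofReal_zero, zero_mul] at ht
    obtain ⟨j, hj⟩ := (ht.eventually (eventually_le_nhds hη2)).exists
    exact ⟨_, by positivity, hj⟩
  refine ⟨l, hl, ?_⟩
  set V := volume (Metric.ball (0 : RN N) 1) with hV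
  have hV0 : V ≠ 0 := (Metric.measure_ball_pos volume _ one_pos).ne'
  have hVt : V ≠ ⊤ := measure_ball_lt_top.ne
  set D : ℝ := l ^ (1 - p) * 2 ^ ((N : ℝ) + p * s) with hD
  -- The powers of the radius combine to `ε ^ (p s)`, which tends to zero.
  have heq : ∀ j : ℕ, (volume (Metric.ball (0 : RN N) (1 / ((j : ℝ) + 1))))⁻¹ *
        (ENNReal.ofReal (l ^ (1 - p) * (2 * (1 / ((j : ℝ) + 1))) ^ ((N : ℝ) + p * s)) *
          ENNReal.ofReal C) =
      ENNReal.ofReal (D * (1 / ((j : ℝ) + 1)) ^ (p * s)) * (V⁻¹ * ENNReal.ofReal C) := by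
    intro j
    have hε : 0 < 1 / ((j : ℝ) + 1) := by positivity
    set ε := 1 / ((j : ℝ) + 1)
    have hεN : 0 < ε ^ N := by positivity
    rw [Measure.addHaar_ball_of_pos volume _ hε, finrank_euclideanSpace_fin,
      ENNReal.mul_inv (Or.inr hVt) (Or.inr hV0), ← ENNReal.ofReal_inv_of_pos hεN,
      Real.mul_rpow (by norm_num) hε.le, Real.rpow_add hε, Real.rpow_natCast]
    have : D * ε ^ (p * s) = (ε ^ N)⁻¹ * (l ^ (1 - p) * (2 ^ ((N : ℝ) + p * s) *
        (ε ^ N * ε ^ (p * s)))) := by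
      rw [hD]; field_simp
    rw [this, ENNReal.ofReal_mul (by positivity : 0 ≤ (ε ^ N)⁻¹)]
    ring
  have ht : Tendsto (fun j : ℕ => ENNReal.ofReal (D * (1 / ((j : ℝ) + 1)) ^ (p * s)) *
      (V⁻¹ * ENNReal.ofReal C)) atTop (𝓝 0) := by
    have h1 : Tendsto (fun j : ℕ => D * (1 / ((j : ℝ) + 1)) ^ (p * s)) atTop (𝓝 0) := by
      have h := (tendsto_one_div_add_atTop_nhds_zero_nat (𝕜 := ℝ)).rpow_const
        (p := p * s) (Or.inr (by positivity))
      rw [Real.zero_rpow (by positivity)] at h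
      simpa using h.const_mul D
    have h2 := ENNReal.Tendsto.mul_const (b := V⁻¹ * ENNReal.ofReal C)
      (ENNReal.tendsto_ofReal h1) (Or.inr (ENNReal.mul_ne_top (ENNReal.inv_ne_top.2 hV0)
        ENNReal.ofReal_ne_top))
    simpa using h2
  obtain ⟨j, hj⟩ := (ht.eventually (eventually_le_nhds hη2)).exists
  refine ⟨j, ?_⟩
  rw [heq]
  exact (add_le_add hlη hj).trans (ENNReal.add_halves η).le

/-- A measurable choice, for each point, of a term of a fixed dense sequence within distance `ε`. -/
lemma exists_measurable_index (N : ℕ) (ε : ℝ) (hε : 0 < ε) :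
    ∃ i : RN N → ℕ, Measurable i ∧
      ∀ x, x ∈ Metric.ball (TopologicalSpace.denseSeq (RN N) (i x)) ε := by
  classical
  have h : ∀ x : RN N, ∃ i, x ∈ Metric.ball (TopologicalSpace.denseSeq (RN N) i) ε := fun x => by
    obtain ⟨i, hi⟩ := (TopologicalSpace.denseRange_denseSeq (RN N)).exists_dist_lt x hε
    exact ⟨i, hi⟩
  exact ⟨fun x => Nat.find (h x), measurable_find h fun k => measurableSet_ball,
    fun x => Nat.find_spec (h x)⟩

/-- Compactness of the embedding of `W^{s,p}` into `L¹(Ω)`, in the form of almost everywhere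
convergence of a subsequence. Ball averages centred on a countable dense set converge along a
diagonal subsequence, and they approximate the functions uniformly in `L¹(Ω)`. -/
theorem exists_subseq_tendsto_ae (hs : 0 < s) (hp : 1 < p) (hΩ : volume Ω ≠ ⊤)
    {u : ℕ → RN N → ℝ} (hu : ∀ n, Integrable (u n) volume) {K C : ℝ}
    (hK : ∀ n, ∫ x, |u n x| ≤ K)
    (hC : ∀ n, ∫⁻ z : RN N × RN N, ENNReal.ofReal
      (|u n z.1 - u n z.2| ^ p / ‖z.1 - z.2‖ ^ ((N : ℝ) + p * s)) ≤ ENNReal.ofReal C) :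
    ∃ φ : ℕ → ℕ, StrictMono φ ∧ ∃ w : RN N → ℝ, Measurable w ∧
      ∀ᵐ x ∂(volume.restrict Ω), Tendsto (fun n => u (φ n) x) atTop (𝓝 (w x)) := by
  have hfin : IsFiniteMeasure (volume.restrict Ω) := ⟨by
    rw [Measure.restrict_apply_univ]; exact hΩ.lt_top⟩
  let q := TopologicalSpace.denseSeq (RN N)
  let ε : ℕ → ℝ := fun j => 1 / ((j : ℝ) + 1)
  have hε : ∀ j, 0 < ε j := fun j => by positivity
  let A : ℕ → ℕ × ℕ → ℝ := fun n ji => ⨍ y in Metric.ball (q ji.2) (ε ji.1), u n y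
  let V : ℕ → ℝ := fun j => (volume.real (Metric.ball (0 : RN N) (ε j)))⁻¹ * K
  have hA : ∀ n ji, |A n ji| ≤ V ji.1 := by
    intro n ji
    simp only [A, V, setAverage_eq, smul_eq_mul, Measure.real]
    rw [Measure.addHaar_ball_center volume, abs_mul, abs_of_nonneg (by positivity)]
    gcongr
    exact (abs_integral_le_integral_abs).trans
      ((setIntegral_le_integral (hu n).abs (ae_of_all _ fun x => abs_nonneg _)).trans (hK n))
  obtain ⟨a, -, φ, hφ, hlim⟩ := (isCompact_univ_pi (fun ji : ℕ × ℕ =>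
    isCompact_Icc (a := -V ji.1) (b := V ji.1))).tendsto_subseq (x := A)
    (fun n ji _ => abs_le.1 (hA n ji))
  have hlim' : ∀ ji, Tendsto (fun n => A (φ n) ji) atTop (𝓝 (a ji)) := fun ji =>
    (tendsto_pi_nhds.1 hlim) ji
  choose i him hi using fun j => exists_measurable_index N (ε j) (hε j)
  let P : ℕ → ℕ → RN N → ℝ := fun j n x => A n (j, i j x)
  have hPm : ∀ j n, Measurable (P j n) := fun j n =>
    (measurable_from_nat (f := fun k => A n (j, k))).comp (him j)
  have hPlim : ∀ j, Tendsto (fun n => ∫⁻ x in Ω, ‖P j (φ n) x - a (j, i j x)‖ₑ) atTop (𝓝 0) := by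
    intro j
    have h := tendsto_lintegral_norm_of_dominated_convergence (μ := volume.restrict Ω)
      (F := fun n => P j (φ n)) (f := fun x => a (j, i j x)) (bound := fun _ => V j)
      (fun n => (hPm j (φ n)).aestronglyMeasurable) (integrable_const _).2
      (fun n => ae_of_all _ fun x => hA (φ n) (j, i j x))
      (ae_of_all _ fun x => hlim' (j, i j x))
    simpa only [ofReal_norm] using h
  have hF : ∀ n, Integrable (u (φ n)) (volume.restrict Ω) := fun n => (hu _).restrict
  let F : ℕ → (RN N →₁[volume.restrict Ω] ℝ) := fun n => (hF n).toL1 (u (φ n))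
  have hcau : CauchySeq F := by
    rw [EMetric.cauchySeq_iff]
    intro η hη
    obtain ⟨η', hη'0, hη'⟩ : ∃ η' : ℝ≥0∞, 0 < η' ∧ η' + η' + (η' + η') < η := by
      obtain ⟨η₁, h1, h2⟩ := exists_between hη
      refine ⟨η₁ / 2 / 2, ENNReal.half_pos (ENNReal.half_pos h1.ne').ne', ?_⟩
      rwa [ENNReal.add_halves, ENNReal.add_halves]
    obtain ⟨l, hl, j, hj⟩ := exists_radius_bound (N := N) hs hp hΩ C hη'0
    have happ : ∀ n, ∫⁻ x in Ω, ‖u n x - P j n x‖ₑ ≤ η' := fun n =>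
      (lintegral_sub_average_le hs hp (hu n) (hε j) hl (fun x => q (i j x)) (hi j)).trans
        (le_trans (by gcongr; exact hC n) hj)
    obtain ⟨n₀, hn₀⟩ := eventually_atTop.1 ((hPlim j).eventually (eventually_le_nhds hη'0))
    have hone : ∀ n ≥ n₀, ∫⁻ x in Ω, ‖u (φ n) x - a (j, i j x)‖ₑ ≤ η' + η' := by
      intro n hn
      calc ∫⁻ x in Ω, ‖u (φ n) x - a (j, i j x)‖ₑ
          ≤ ∫⁻ x in Ω, (‖u (φ n) x - P j (φ n) x‖ₑ + ‖P j (φ n) x - a (j, i j x)‖ₑ) := by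
            refine lintegral_mono fun x => ?_
            refine le_trans (le_of_eq ?_) (enorm_add_le _ _)
            rw [sub_add_sub_cancel]
        _ = _ := lintegral_add_left'
            ((hF n).aestronglyMeasurable.sub (hPm j _).aestronglyMeasurable).enorm _
        _ ≤ η' + η' := add_le_add (happ _) (hn₀ n hn)
    refine ⟨n₀, fun m hm n hn => lt_of_le_of_lt ?_ hη'⟩
    rw [Integrable.edist_toL1_toL1]
    have ham : Measurable fun x => a (j, i j x) :=
      (measurable_from_nat (f := fun k => a (j, k))).comp (him j)
    calc ∫⁻ x in Ω, edist (u (φ m) x) (u (φ n) x)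
        ≤ ∫⁻ x in Ω, (‖u (φ m) x - a (j, i j x)‖ₑ + ‖u (φ n) x - a (j, i j x)‖ₑ) := by
          refine lintegral_mono fun x => ?_
          rw [← edist_eq_enorm_sub, ← edist_eq_enorm_sub]
          exact edist_triangle_right _ _ _
      _ = _ := lintegral_add_left'
          ((hF m).aestronglyMeasurable.sub ham.aestronglyMeasurable).enorm _
      _ ≤ η' + η' + (η' + η') := add_le_add (hone m hm) (hone n hn)
  obtain ⟨w, hw⟩ := cauchySeq_tendsto_of_complete hcau
  obtain ⟨ns, hns, hae⟩ := (tendstoInMeasure_of_tendsto_Lp hw).exists_seq_tendsto_ae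
  refine ⟨φ ∘ ns, hφ.comp hns, w, (Lp.stronglyMeasurable w).measurable, ?_⟩
  have hcoe : ∀ᵐ x ∂(volume.restrict Ω), ∀ n, F n x = u (φ n) x :=
    ae_all_iff.2 fun n => (hF n).coeFn_toL1
  filter_upwards [hae, hcoe] with x hx hc
  simpa only [hc, Function.comp_apply] using hx

end Compactness

/-! ### Carathéodory functions -/

section Caratheodory

lemma exists_measurable_version {N : ℕ} {Ω : Set (RN N)} {f : RN N → ℝ → ℝ}
    (hf : Caratheodory Ω f) :
    ∃ g : RN N → ℝ → ℝ, (∀ t, Measurable fun x => g x t) ∧ (∀ x, Continuous (g x)) ∧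
      ∀ᵐ x ∂(volume.restrict Ω), ∀ t, g x t = f x t := by
  classical
  have hae : ∀ᵐ x ∂(volume.restrict Ω),
      Continuous (f x) ∧ ∀ q : ℚ, f x q = (hf.1 q).mk (fun x => f x q) x :=
    hf.2.and (ae_all_iff.2 fun q => (hf.1 q).ae_eq_mk)
  obtain ⟨T, hT, hTm, hT0⟩ := exists_measurable_superset_of_null (ae_iff.1 hae)
  have hTmem : ∀ x, x ∉ T → Continuous (f x) ∧
      ∀ q : ℚ, f x q = (hf.1 q).mk (fun x => f x q) x := fun x hx =>
    by_contra fun h => hx (hT h)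
  refine ⟨fun x t => if x ∈ T then 0 else f x t, fun t => ?_, fun x => ?_, ?_⟩
  · obtain ⟨q, hq, hqt⟩ := mem_closure_iff_seq_limit.1 (Rat.denseRange_cast (𝕜 := ℝ) t)
    choose q' hq' using hq
    refine measurable_of_tendsto_metrizable
      (f := fun n x => if x ∈ T then 0 else (hf.1 (q' n)).mk (fun x => f x (q' n)) x)
      (fun n => Measurable.ite hTm measurable_const (hf.1 _).measurable_mk) ?_
    refine tendsto_pi_nhds.2 fun x => ?_
    by_cases hx : x ∈ T
    · simp [hx]
    · simp only [hx, if_false]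
      have h := ((hTmem x hx).1.tendsto t).comp hqt
      refine h.congr fun n => ?_
      rw [Function.comp_apply, ← hq' n]
      exact (hTmem x hx).2 (q' n)
  · by_cases hx : x ∈ T
    · simpa [hx] using continuous_const
    · simpa [hx] using (hTmem x hx).1
  · have : ∀ᵐ x ∂(volume.restrict Ω), x ∉ T := by
      rw [ae_iff]; simpa using hT0
    filter_upwards [this] with x hx t
    simp [hx]

/-- A measurable selection at which a Carathéodory function attains at least half of its supremum
over an order interval: the first suitable point among countably many candidates. -/
lemma exists_measurable_half_max {X : Type*} [MeasurableSpace X] {f : X → ℝ → ℝ}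
    (hm : ∀ t, Measurable fun x => f x t) (hc : ∀ x, Continuous (f x)) {a b : X → ℝ}
    (ha : Measurable a) (hb : Measurable b) (hab : ∀ x, a x ≤ b x) :
    ∃ w : X → ℝ, Measurable w ∧ (∀ x, a x ≤ w x ∧ w x ≤ b x) ∧
      ∀ x t, a x ≤ t → t ≤ b x → |f x t| ≤ 2 * |f x (w x)| := by
  classical
  have hjoint : Measurable (Function.uncurry fun t x => f x t) :=
    measurable_uncurry_of_continuous_of_measurable (u := fun t x => f x t) (fun x => hc x) hm
  let c : ℕ → unitInterval := TopologicalSpace.denseSeq unitInterval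
  let W : ℕ → X → ℝ := fun n x => a x + c n * (b x - a x)
  have hW : ∀ n, Measurable (W n) := fun n => by fun_prop
  have hfW : ∀ n, Measurable fun x => |f x (W n x)| := fun n =>
    measurable_norm.comp (hjoint.comp ((hW n).prodMk measurable_id))
  -- Values at the candidates control all values, by density and continuity.
  have hdense : ∀ x K, (∀ m, |f x (W m x)| ≤ K) →
      ∀ θ : unitInterval, |f x (a x + θ * (b x - a x))| ≤ K := by
    intro x K hK θ
    have hcl : IsClosed {θ : unitInterval | |f x (a x + θ * (b x - a x))| ≤ K} := by
      have := hc x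
      exact isClosed_le (by fun_prop) continuous_const
    have hsub : Set.range c ⊆ {θ : unitInterval | |f x (a x + θ * (b x - a x))| ≤ K} := by
      rintro _ ⟨m, rfl⟩; exact hK m
    exact hcl.closure_subset_iff.2 hsub
      (TopologicalSpace.denseRange_denseSeq unitInterval θ)
  have hex : ∀ x, ∃ n, ∀ m, |f x (W m x)| ≤ 2 * |f x (W n x)| := by
    intro x
    by_contra! hcon
    have hcont : Continuous fun θ : unitInterval => |f x (a x + θ * (b x - a x))| := by
      have := hc x
      fun_prop
    obtain ⟨θ₀, -, hθ₀⟩ := isCompact_univ.exists_isMaxOn (Set.univ_nonempty) hcont.continuousOn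
    set M := |f x (a x + θ₀ * (b x - a x))| with hM
    have hhalf : ∀ n, |f x (W n x)| ≤ M / 2 := fun n => by
      obtain ⟨m, hm⟩ := hcon n
      have : |f x (W m x)| ≤ M := hθ₀ (Set.mem_univ (c m))
      linarith
    have h1 : M ≤ M / 2 := hdense x _ hhalf θ₀
    obtain ⟨m, hm⟩ := hcon 0
    have h2 : |f x (W m x)| ≤ M := hθ₀ (Set.mem_univ (c m))
    have h3 := abs_nonneg (f x (W 0 x))
    linarith
  have hset : ∀ n, MeasurableSet {x | ∀ m, |f x (W m x)| ≤ 2 * |f x (W n x)|} := fun n => by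
    rw [Set.ofPred_forall]
    exact MeasurableSet.iInter fun m => measurableSet_le (hfW m) ((hfW n).const_mul 2)
  refine ⟨fun x => W (Nat.find (hex x)) x, Measurable.find hW hset hex, fun x => ?_,
    fun x t h1 h2 => ?_⟩
  · have h0 := (c (Nat.find (hex x))).2.1
    have h1 := (c (Nat.find (hex x))).2.2
    have := hab x
    simp only [W]
    constructor <;> nlinarith
  · have hb' := hdense x _ (Nat.find_spec (hex x))
    rcases (hab x).eq_or_lt with h | h
    · have := hb' 0
      rw [show ((0 : unitInterval) : ℝ) = 0 from rfl, zero_mul, add_zero] at this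
      rwa [show t = a x by linarith]
    · have hpos : 0 < b x - a x := by linarith
      have := hb' ⟨(t - a x) / (b x - a x), div_nonneg (by linarith) hpos.le,
        (div_le_one hpos).2 (by linarith)⟩
      simp only at this
      rwa [div_mul_cancel₀ _ hpos.ne', add_sub_cancel] at this

/-- The primitive `∫_0^t g(x, τ) dτ` of the reaction term. -/
def primitive {X : Type*} (g : X → ℝ → ℝ) (x : X) (t : ℝ) : ℝ := ∫ τ in (0 : ℝ)..t, g x τ

variable {X : Type*} {g : X → ℝ → ℝ} {H : X → ℝ}

lemma hasDerivAt_primitive (hc : ∀ x, Continuous (g x)) (x : X) (t : ℝ) :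
    HasDerivAt (primitive g x) (g x t) t :=
  intervalIntegral.integral_hasDerivAt_right ((hc x).intervalIntegrable _ _)
    ((hc x).stronglyMeasurableAtFilter _ _) (hc x).continuousAt

lemma abs_primitive_le (hH : ∀ x t, |g x t| ≤ H x) (x : X) (t : ℝ) :
    |primitive g x t| ≤ H x * |t| := by
  have := intervalIntegral.norm_integral_le_of_norm_le_const (a := 0) (b := t) (f := g x)
    (C := H x) fun τ _ => hH x τ
  simpa [primitive] using this

lemma measurable_uncurry_caratheodory [MeasurableSpace X] (hm : ∀ t, Measurable fun x => g x t)
    (hc : ∀ x, Continuous (g x)) : Measurable (Function.uncurry fun t x => g x t) :=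
  measurable_uncurry_of_continuous_of_measurable (u := fun t x => g x t) (fun x => hc x) hm

lemma measurable_primitive [MeasurableSpace X] (hm : ∀ t, Measurable fun x => g x t)
    (hc : ∀ x, Continuous (g x)) (t : ℝ) : Measurable fun x => primitive g x t := by
  have h : StronglyMeasurable (Function.uncurry fun x t => g x t) :=
    ((measurable_uncurry_caratheodory hm hc).comp measurable_swap).stronglyMeasurable
  unfold primitive intervalIntegral
  exact h.integral_prod_right.measurable.sub h.integral_prod_right.measurable

lemma measurable_uncurry_primitive [MeasurableSpace X] (hm : ∀ t, Measurable fun x => g x t)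
    (hc : ∀ x, Continuous (g x)) : Measurable (Function.uncurry fun t x => primitive g x t) :=
  measurable_uncurry_caratheodory (measurable_primitive hm hc) fun x =>
    continuous_iff_continuousAt.2 fun t => (hasDerivAt_primitive hc x t).continuousAt

lemma aemeasurable_comp_caratheodory [MeasurableSpace X] {μ : Measure X}
    (hm : ∀ t, Measurable fun x => g x t) (hc : ∀ x, Continuous (g x)) {u : X → ℝ}
    (hu : AEMeasurable u μ) : AEMeasurable (fun x => g x (u x)) μ :=
  (measurable_uncurry_caratheodory hm hc).comp_aemeasurable (hu.prodMk aemeasurable_id)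

lemma aemeasurable_comp_primitive [MeasurableSpace X] {μ : Measure X}
    (hm : ∀ t, Measurable fun x => g x t) (hc : ∀ x, Continuous (g x)) {u : X → ℝ}
    (hu : AEMeasurable u μ) : AEMeasurable (fun x => primitive g x (u x)) μ :=
  (measurable_uncurry_primitive hm hc).comp_aemeasurable (hu.prodMk aemeasurable_id)

end Caratheodory

/-! ### The energy functional and its minimisers -/

section Energy

open scoped ENNReal

variable {N : ℕ} {Ω : Set (RN N)} {s p α r : ℝ} {g : RN N → ℝ → ℝ} {H a b u w : RN N → ℝ}

/-- The energy of the logistic Choquard problem, shifted by the constant `∫_Ω H b` that makes the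
reaction part nonnegative on functions `0 ≤ u ≤ b` when `|g| ≤ H`. It takes values in `[0, ∞]`, so
that its lower semicontinuity is Fatou's lemma. -/
def energy (Ω : Set (RN N)) (s p α r : ℝ) (g : RN N → ℝ → ℝ) (H b u : RN N → ℝ) : ℝ≥0∞ :=
  (∫⁻ z : RN N × RN N, ENNReal.ofReal
      (|u z.1 - u z.2| ^ p / ‖z.1 - z.2‖ ^ ((N : ℝ) + p * s) / p)) +
    (∫⁻ z in Ω ×ˢ Ω, ENNReal.ofReal
      (|u z.1| ^ r * |u z.2| ^ r / ‖z.1 - z.2‖ ^ α / (2 * r))) +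
    ∫⁻ x in Ω, ENNReal.ofReal (H x * b x - primitive g x (u x))

/-- The order interval `[a, b]`, up to null sets. -/
def OrderInterval (a b u : RN N → ℝ) : Prop :=
  AEMeasurable u volume ∧ ∀ᵐ x ∂(volume : Measure (RN N)), a x ≤ u x ∧ u x ≤ b x

lemma aemeasurable_choquard_density {β : Measure (RN N × RN N)} (hβ : β ≪ volume)
    (hu : AEMeasurable u volume) :
    AEMeasurable (fun z : RN N × RN N => |u z.1| ^ r * |u z.2| ^ r / ‖z.1 - z.2‖ ^ α) β := by
  have h1 := (measurable_norm.comp_aemeasurable (aemeasurable_fst hu)).pow_const r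
  have h2 := (measurable_norm.comp_aemeasurable (aemeasurable_snd hu)).pow_const r
  have h3 : AEMeasurable (fun z : RN N × RN N => |u z.1| ^ r * |u z.2| ^ r / ‖z.1 - z.2‖ ^ α)
    volume := (h1.mul h2).div (by fun_prop)
  exact h3.mono_ac hβ

lemma add_add_liminf_le (A B C : ℕ → ℝ≥0∞) :
    liminf A atTop + liminf B atTop + liminf C atTop ≤ liminf (fun n => A n + B n + C n) atTop := by
  have key : ∀ A B : ℕ → ℝ≥0∞,
      liminf A atTop + liminf B atTop ≤ liminf (fun n => A n + B n) atTop := by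
    intro A B
    simp only [liminf_eq_iSup_iInf_of_nat]
    rw [ENNReal.iSup_add_iSup_of_monotone
      (fun m n h => biInf_mono fun i hi => h.trans hi)
      (fun m n h => biInf_mono fun i hi => h.trans hi)]
    refine iSup_mono fun n => le_iInf₂ fun i hi => add_le_add (iInf₂_le i hi) (iInf₂_le i hi)
  exact (add_le_add_left (key A B) _).trans (key _ C)

lemma energy_le_liminf (hp : 1 < p) (hr : 1 < r) (hm : ∀ t, Measurable fun x => g x t)
    (hc : ∀ x, Continuous (g x)) (hH : Measurable H) (hb : Measurable b) {u : ℕ → RN N → ℝ}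
    (hu : ∀ n, AEMeasurable (u n) volume)
    (hlim : ∀ᵐ x ∂(volume : Measure (RN N)), Tendsto (fun n => u n x) atTop (𝓝 (w x))) :
    energy Ω s p α r g H b w ≤ liminf (fun n => energy Ω s p α r g H b (u n)) atTop := by
  refine le_trans ?_ (add_add_liminf_le _ _ _)
  have hlim2 := ae_prod_of_ae hlim
  unfold energy
  gcongr ?_ + ?_ + ?_
  · refine le_trans (lintegral_mono_ae ?_) (lintegral_liminf_le' fun n =>
      ((aemeasurable_gagliardo (hu n)).div_const p).ennreal_ofReal)
    filter_upwards [hlim2] with z hz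
    refine (Tendsto.liminf_eq ?_).ge
    refine ENNReal.tendsto_ofReal (((Tendsto.rpow_const ?_ (Or.inr (by linarith))).div_const
      _).div_const _)
    exact (hz.1.sub hz.2).abs
  · refine le_trans (lintegral_mono_ae ?_) (lintegral_liminf_le' fun n =>
      ((aemeasurable_choquard_density Measure.restrict_le_self.absolutelyContinuous
        (hu n)).div_const _).ennreal_ofReal)
    filter_upwards [ae_restrict_of_ae hlim2] with z hz
    refine (Tendsto.liminf_eq ?_).ge
    exact ENNReal.tendsto_ofReal ((((hz.1.abs.rpow_const (Or.inr (by linarith))).mul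
      (hz.2.abs.rpow_const (Or.inr (by linarith)))).div_const _).div_const _)
  · refine le_trans (lintegral_mono_ae ?_) (lintegral_liminf_le' fun n =>
      ((hH.mul hb).aemeasurable.sub
        (aemeasurable_comp_primitive hm hc (hu n).restrict)).ennreal_ofReal)
    filter_upwards [ae_restrict_of_ae hlim] with x hx
    refine (Tendsto.liminf_eq ?_).ge
    exact ENNReal.tendsto_ofReal (tendsto_const_nhds.sub
      (((hasDerivAt_primitive hc x _).continuousAt.tendsto).comp hx))

lemma MemW0.integrable (hp : 1 < p) (hΩ : volume Ω ≠ ⊤)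
    (hb : MemW0 Ω s p b) : Integrable b volume := by
  have hfin : IsFiniteMeasure (volume.restrict Ω) := ⟨by
    rw [Measure.restrict_apply_univ]; exact hΩ.lt_top⟩
  have h1 : IntegrableOn b Ω volume := (hb.memLp.restrict Ω).integrable
    (by rw [← ENNReal.ofReal_one]; exact ENNReal.ofReal_le_ofReal hp.le)
  exact h1.integrable_of_ae_notMem_eq_zero hb.eq_zero

/-- The energy attains its minimum over the order interval `[a, b]`, by the direct method. -/
theorem exists_energy_minimizer (hs : 0 < s) (hp : 1 < p) (hr : 1 < r) (hΩm : MeasurableSet Ω)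
    (hΩ : volume Ω ≠ ⊤) (hm : ∀ t, Measurable fun x => g x t)
    (hc : ∀ x, Continuous (g x)) (hH : Measurable H) (hb : Measurable b)
    (h0a : ∀ x, 0 ≤ a x) (hab : ∀ x, a x ≤ b x)
    (haW : MemW0 Ω s p a) (hbW : MemW0 Ω s p b)
    (hfin : energy Ω s p α r g H b a ≠ ⊤) :
    ∃ u, AEMeasurable u volume ∧ (∀ x, a x ≤ u x ∧ u x ≤ b x) ∧ ∀ w, OrderInterval a b w →
      energy Ω s p α r g H b u ≤ energy Ω s p α r g H b w := by
  set E := energy Ω s p α r g H b with hE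
  have haM : OrderInterval a b a := ⟨haW.aemeasurable, ae_of_all _ fun x => ⟨le_rfl, hab x⟩⟩
  set m : ℝ≥0∞ := ⨅ w : {w // OrderInterval a b w}, E w with hmdef
  have hmt : m ≠ ⊤ := ne_top_of_le_ne_top hfin (iInf_le (fun w : {w // OrderInterval a b w} =>
    E w) ⟨a, haM⟩)
  have hex : ∀ n : ℕ, ∃ w, OrderInterval a b w ∧ E w < m + ENNReal.ofReal (1 / ((n : ℝ) + 1)) := by
    intro n
    have : m < m + ENNReal.ofReal (1 / ((n : ℝ) + 1)) :=
      ENNReal.lt_add_right hmt (by simp; positivity)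
    obtain ⟨w, hw⟩ := iInf_lt_iff.1 this
    exact ⟨w, w.2, hw⟩
  choose u huM huE using hex
  have hbI := hbW.integrable hp hΩ
  have hu_abs : ∀ n, ∀ᵐ x ∂(volume : Measure (RN N)), |u n x| ≤ b x := fun n => by
    filter_upwards [(huM n).2] with x hx
    rw [abs_of_nonneg ((h0a x).trans hx.1)]
    exact hx.2
  have huI : ∀ n, Integrable (u n) volume := fun n =>
    hbI.mono' (huM n).1.aestronglyMeasurable (hu_abs n)
  have hK : ∀ n, ∫ x, |u n x| ≤ ∫ x, b x := fun n =>
    integral_mono_ae (huI n).abs hbI (hu_abs n)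
  have hC : ∀ n, ∫⁻ z : RN N × RN N, ENNReal.ofReal
      (|u n z.1 - u n z.2| ^ p / ‖z.1 - z.2‖ ^ ((N : ℝ) + p * s)) ≤
      ENNReal.ofReal (p * (m + 1).toReal) := by
    intro n
    have h1 : E (u n) ≤ m + 1 := (huE n).le.trans (by
      gcongr
      rw [ENNReal.ofReal_le_one, div_le_one (by positivity)]
      linarith [Nat.cast_nonneg (α := ℝ) n])
    rw [ENNReal.ofReal_mul (by linarith), ENNReal.ofReal_toReal (by simp [hmt])]
    calc ∫⁻ z : RN N × RN N, ENNReal.ofReal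
          (|u n z.1 - u n z.2| ^ p / ‖z.1 - z.2‖ ^ ((N : ℝ) + p * s))
        = ENNReal.ofReal p * ∫⁻ z : RN N × RN N, ENNReal.ofReal
          (|u n z.1 - u n z.2| ^ p / ‖z.1 - z.2‖ ^ ((N : ℝ) + p * s) / p) := by
          rw [← lintegral_const_mul' _ _ ENNReal.ofReal_ne_top]
          refine lintegral_congr fun z => ?_
          rw [← ENNReal.ofReal_mul (by linarith), mul_div_cancel₀ _ (by linarith)]
      _ ≤ ENNReal.ofReal p * (m + 1) := by
          gcongr
          exact (le_self_add.trans le_self_add).trans h1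
  obtain ⟨φ, hφ, w, hwm, hw⟩ := exists_subseq_tendsto_ae hs hp hΩ huI hK hC
  set U : RN N → ℝ := fun x => max (a x) (min (Ω.indicator w x) (b x)) with hU
  have hlim : ∀ᵐ x ∂(volume : Measure (RN N)),
      Tendsto (fun n => u (φ n) x) atTop (𝓝 (U x)) := by
    filter_upwards [(ae_restrict_iff' hΩm).1 hw, haW.eq_zero, hbW.eq_zero,
      ae_all_iff.2 fun n => (huM n).2] with x h1 h2 h3 h4
    have hlim₀ : Tendsto (fun n => u (φ n) x) atTop (𝓝 (Ω.indicator w x)) := by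
      by_cases hx : x ∈ Ω
      · simpa [hx] using h1 hx
      · have : ∀ n, u n x = 0 := fun n =>
          le_antisymm ((h4 n).2.trans (h3 hx).le) ((h2 hx).ge.trans (h4 n).1)
        simp [hx, this]
    have h5 := ge_of_tendsto' hlim₀ fun n => (h4 (φ n)).1
    have h6 := le_of_tendsto' hlim₀ fun n => (h4 (φ n)).2
    rwa [show U x = Ω.indicator w x by rw [hU]; simp only; rw [min_eq_left h6, max_eq_right h5]]
  refine ⟨U, haW.aemeasurable.max ((hwm.indicator hΩm).min hb).aemeasurable,
    fun x => ⟨le_max_left _ _, max_le (hab x) (min_le_right _ _)⟩, fun v hv => ?_⟩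
  have h1 : E U ≤ liminf (fun n => E (u (φ n))) atTop :=
    energy_le_liminf hp hr hm hc hH hb (fun n => (huM _).1) hlim
  have h2 : Tendsto (fun n => m + ENNReal.ofReal (1 / (((φ n : ℕ) : ℝ) + 1))) atTop (𝓝 m) := by
    have := (ENNReal.tendsto_ofReal (tendsto_one_div_add_atTop_nhds_zero_nat (𝕜 := ℝ))).comp
      hφ.tendsto_atTop
    simpa using tendsto_const_nhds.add this
  have h3 : liminf (fun n => E (u (φ n))) atTop ≤ m := by
    rw [← h2.liminf_eq]
    exact liminf_le_liminf (Eventually.of_forall fun n => (huE (φ n)).le)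
  exact (h1.trans h3).trans (iInf_le (fun w : {w // OrderInterval a b w} => E w) ⟨v, hv⟩)

end Energy

/-! ### Integrability of the Choquard term -/

section Riesz

open scoped ENNReal

variable {N : ℕ} {Ω : Set (RN N)} {α r : ℝ} {h u v : RN N → ℝ}

lemma volume_restrict_prod (Ω : Set (RN N)) :
    (volume : Measure (RN N × RN N)).restrict (Ω ×ˢ Ω) =
      (volume.restrict Ω).prod (volume.restrict Ω) :=
  (Measure.prod_restrict Ω Ω).symm

lemma nontrivial_RN (hN : 2 ≤ N) : Nontrivial (RN N) := by
  have : Nonempty (Fin N) := ⟨⟨0, by omega⟩⟩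
  infer_instance

lemma ae_fst_ne_snd (hN : 2 ≤ N) :
    ∀ᵐ z ∂(volume : Measure (RN N × RN N)), z.1 ≠ z.2 := by
  have := nontrivial_RN hN
  have h : (volume : Measure (RN N × RN N)) (Set.diagonal (RN N)) = 0 := by
    refine (Measure.measure_prod_null measurableSet_diagonal).2 (ae_of_all _ fun x => ?_)
    have : Prod.mk x ⁻¹' Set.diagonal (RN N) = {x} := by
      ext y; simp [eq_comm]
    simp only [this, measure_singleton, Pi.zero_apply]
  rw [ae_iff]
  convert h using 2
  ext z; simp

lemma exists_riesz_bound (hN : 2 ≤ N) (hΩb : Bornology.IsBounded Ω) (hΩm : MeasurableSet Ω)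
    (hαN : α < N) :
    ∃ K : ℝ≥0∞, K ≠ ⊤ ∧
      ∀ x ∈ Ω, ∫⁻ y in Ω, ENNReal.ofReal (1 / ‖x - y‖ ^ α) ≤ K := by
  have := nontrivial_RN hN
  obtain ⟨R, hR0, hR⟩ := hΩb.subset_ball_lt 0 0
  have hint : IntegrableOn (fun z : RN N => 1 / ‖z‖ ^ α) (Metric.ball 0 (2 * R)) volume := by
    refine (integrableOn_fun_norm_addHaar volume (f := fun t => 1 / t ^ α)).2 ?_
    rw [finrank_euclideanSpace_fin]
    have h1 : IntegrableOn (fun t : ℝ => t ^ ((N : ℝ) - 1 - α)) (Set.Ioo 0 (2 * R)) volume :=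
      (intervalIntegral.integrableOn_Ioo_rpow_iff (by positivity)).2 (by linarith)
    refine h1.congr_fun (fun t ht => ?_) measurableSet_Ioo
    simp only [smul_eq_mul]
    rw [Real.rpow_sub ht.1, ← Real.rpow_natCast t (N - 1), Nat.cast_sub (by omega), Nat.cast_one]
    ring
  refine ⟨∫⁻ z in Metric.ball (0 : RN N) (2 * R), ENNReal.ofReal (1 / ‖z‖ ^ α),
    hint.lintegral_lt_top.ne, fun x hx => ?_⟩
  set F : RN N → ℝ≥0∞ :=
    (Metric.ball (0 : RN N) (2 * R)).indicator fun z => ENNReal.ofReal (1 / ‖z‖ ^ α) with hF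
  calc ∫⁻ y in Ω, ENNReal.ofReal (1 / ‖x - y‖ ^ α) ≤ ∫⁻ y in Ω, F (x - y) := by
        refine setLIntegral_mono' hΩm fun y hy => ?_
        have hmem : x - y ∈ Metric.ball (0 : RN N) (2 * R) := by
          have h1 := mem_ball_zero_iff.1 (hR hx)
          have h2 := mem_ball_zero_iff.1 (hR hy)
          rw [mem_ball_zero_iff]
          linarith [norm_sub_le x y]
        rw [hF, Set.indicator_of_mem hmem]
    _ ≤ ∫⁻ y, F (x - y) := lintegral_mono' Measure.restrict_le_self le_rfl
    _ = ∫⁻ y, F y := lintegral_sub_left_eq_self F x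
    _ = _ := lintegral_indicator measurableSet_ball _

lemma integrableOn_riesz_fst (hN : 2 ≤ N) (hΩb : Bornology.IsBounded Ω) (hΩm : MeasurableSet Ω)
    (hαN : α < N) (hh : IntegrableOn h Ω volume) :
    IntegrableOn (fun z : RN N × RN N => h z.1 / ‖z.1 - z.2‖ ^ α) (Ω ×ˢ Ω) volume := by
  rw [IntegrableOn, volume_restrict_prod]
  obtain ⟨K, hK, hKb⟩ := exists_riesz_bound hN hΩb hΩm hαN
  have hmeas : AEMeasurable (fun z : RN N × RN N => h z.1 / ‖z.1 - z.2‖ ^ α)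
      ((volume.restrict Ω).prod (volume.restrict Ω)) :=
    (AEMeasurable.comp_fst hh.aestronglyMeasurable.aemeasurable).div (by fun_prop)
  refine ⟨hmeas.aestronglyMeasurable, ?_⟩
  rw [hasFiniteIntegral_iff_enorm, lintegral_prod _ hmeas.enorm]
  calc ∫⁻ x in Ω, ∫⁻ y in Ω, ‖h x / ‖x - y‖ ^ α‖ₑ
      ≤ ∫⁻ x in Ω, ‖h x‖ₑ * K := by
        refine setLIntegral_mono' hΩm fun x hx => ?_
        calc ∫⁻ y in Ω, ‖h x / ‖x - y‖ ^ α‖ₑ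
            = ∫⁻ y in Ω, ‖h x‖ₑ * ENNReal.ofReal (1 / ‖x - y‖ ^ α) := by
              refine lintegral_congr fun y => ?_
              rw [div_eq_mul_one_div, enorm_mul,
                Real.enorm_of_nonneg (r := 1 / ‖x - y‖ ^ α) (by positivity)]
          _ = ‖h x‖ₑ * ∫⁻ y in Ω, ENNReal.ofReal (1 / ‖x - y‖ ^ α) :=
              lintegral_const_mul' _ _ enorm_ne_top
          _ ≤ ‖h x‖ₑ * K := by gcongr; exact hKb x hx
    _ = (∫⁻ x in Ω, ‖h x‖ₑ) * K := lintegral_mul_const' _ _ hK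
    _ < ⊤ := ENNReal.mul_lt_top hh.2 hK.lt_top

lemma integrableOn_swap {F : RN N × RN N → ℝ} (hF : IntegrableOn F (Ω ×ˢ Ω) volume) :
    IntegrableOn (fun z => F z.swap) (Ω ×ˢ Ω) volume := by
  rw [IntegrableOn, volume_restrict_prod] at hF ⊢
  exact hF.swap

lemma integral_swap_square (F : RN N × RN N → ℝ) :
    ∫ z in Ω ×ˢ Ω, F z.swap = ∫ z in Ω ×ˢ Ω, F z := by
  rw [volume_restrict_prod]
  exact integral_prod_swap F

/-- On a bounded set the Riesz kernel is bounded below, so finiteness of the double integral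
controls the `L^r(Ω)` norm. -/
lemma integrableOn_rpow_of_choquard (hN : 2 ≤ N) (hΩb : Bornology.IsBounded Ω)
    (hΩm : MeasurableSet Ω) (hα0 : 0 < α) (hu : AEMeasurable u volume)
    (hD : IntegrableOn (fun z : RN N × RN N => |u z.1| ^ r * |u z.2| ^ r / ‖z.1 - z.2‖ ^ α)
      (Ω ×ˢ Ω) volume) :
    IntegrableOn (fun x => |u x| ^ r) Ω volume := by
  obtain ⟨R, hR0, hR⟩ := hΩb.subset_ball_lt 0 0
  have hur : AEMeasurable (fun x => |u x| ^ r) volume :=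
    (measurable_norm.comp_aemeasurable hu).pow_const r
  have hprod : IntegrableOn (fun z : RN N × RN N => |u z.1| ^ r * |u z.2| ^ r)
      (Ω ×ˢ Ω) volume := by
    refine (hD.const_mul ((2 * R) ^ α)).mono' (AEMeasurable.aestronglyMeasurable
      (((aemeasurable_fst hur).mul (aemeasurable_snd hur)).restrict)) ?_
    filter_upwards [ae_restrict_of_ae (ae_fst_ne_snd hN), ae_restrict_mem (hΩm.prod hΩm)]
      with z hz hzΩ
    rw [Real.norm_of_nonneg (by positivity), mul_div_assoc']
    have h1 := mem_ball_zero_iff.1 (hR hzΩ.1)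
    have h2 := mem_ball_zero_iff.1 (hR hzΩ.2)
    have h3 : 0 < ‖z.1 - z.2‖ := norm_pos_iff.2 (sub_ne_zero.2 hz)
    have h4 : ‖z.1 - z.2‖ ≤ 2 * R := by linarith [norm_sub_le z.1 z.2]
    rw [le_div_iff₀ (by positivity), mul_comm]
    gcongr
  rw [IntegrableOn, volume_restrict_prod] at hprod
  have h1 := hprod.2
  rw [hasFiniteIntegral_iff_enorm] at h1
  simp_rw [enorm_mul] at h1
  rw [lintegral_prod_mul hur.restrict.enorm hur.restrict.enorm] at h1
  refine ⟨hur.restrict.aestronglyMeasurable, ?_⟩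
  rw [hasFiniteIntegral_iff_enorm]
  by_contra hcon
  rw [not_lt, top_le_iff] at hcon
  rw [hcon] at h1
  simp at h1

/-- Finiteness of the Choquard energy is stable under the addition of constants. -/
lemma integrableOn_choquard_add_const (hN : 2 ≤ N) (hΩb : Bornology.IsBounded Ω)
    (hΩm : MeasurableSet Ω) (hα0 : 0 < α) (hαN : α < N) (hr : 1 < r) (hu : AEMeasurable u volume)
    (hD : IntegrableOn (fun z : RN N × RN N => |u z.1| ^ r * |u z.2| ^ r / ‖z.1 - z.2‖ ^ α)
      (Ω ×ˢ Ω) volume) {C : ℝ} (hC : 0 ≤ C) :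
    IntegrableOn (fun z : RN N × RN N =>
      (|u z.1| + C) ^ r * (|u z.2| + C) ^ r / ‖z.1 - z.2‖ ^ α) (Ω ×ˢ Ω) volume := by
  have hur := integrableOn_rpow_of_choquard hN hΩb hΩm hα0 hu hD
  have h1 := integrableOn_riesz_fst hN hΩb hΩm hαN (h := fun x => |u x| ^ r) hur
  have h2 := integrableOn_swap h1
  have h3 := integrableOn_riesz_fst hN hΩb hΩm hαN (h := fun _ => (1 : ℝ))
    (integrableOn_const hΩb.measure_lt_top.ne)
  have hmeas : AEMeasurable (fun z : RN N × RN N =>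
      (|u z.1| + C) ^ r * (|u z.2| + C) ^ r / ‖z.1 - z.2‖ ^ α) volume :=
    ((((measurable_norm.comp_aemeasurable (aemeasurable_fst hu)).add_const C).pow_const r).mul
      (((measurable_norm.comp_aemeasurable (aemeasurable_snd hu)).add_const C).pow_const r)).div
      (by fun_prop)
  refine ((((hD.add (h1.const_mul (C ^ r))).add (h2.const_mul (C ^ r))).add
    (h3.const_mul (C ^ r * C ^ r))).const_mul (2 ^ r * 2 ^ r)).mono'
    hmeas.restrict.aestronglyMeasurable (ae_of_all _ fun z => ?_)
  rw [Real.norm_of_nonneg (by positivity)]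
  simp only [Pi.add_apply, Prod.fst_swap, Prod.snd_swap]
  rw [norm_sub_rev z.2 z.1]
  have hA := rpow_add_le_two_rpow_mul (q := r) (by linarith) (abs_nonneg (u z.1)) hC
  have hB := rpow_add_le_two_rpow_mul (q := r) (by linarith) (abs_nonneg (u z.2)) hC
  calc (|u z.1| + C) ^ r * (|u z.2| + C) ^ r / ‖z.1 - z.2‖ ^ α
      ≤ (2 ^ r * (|u z.1| ^ r + C ^ r)) * (2 ^ r * (|u z.2| ^ r + C ^ r)) / ‖z.1 - z.2‖ ^ α := by
        gcongr
    _ = _ := by ring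

lemma aemeasurable_choquardIntegrand {a : RN N → ℝ} (ha : AEMeasurable a volume)
    (hu : AEMeasurable u volume) (hv : AEMeasurable v volume) :
    AEMeasurable (choquardIntegrand α r a u v) volume :=
  ((((measurable_norm.comp_aemeasurable (aemeasurable_snd ha)).pow_const r).mul
    ((measurable_spow _).comp_aemeasurable (aemeasurable_fst hu))).mul (aemeasurable_fst hv)).div
    (by fun_prop)

/-- The Choquard term converges absolutely for bounded test functions. -/
lemma choquardIntegrable_of_bounded (hN : 2 ≤ N) (hΩb : Bornology.IsBounded Ω)
    (hΩm : MeasurableSet Ω) (hα0 : 0 < α) (hαN : α < N) (hr : 1 < r) (hu : AEMeasurable u volume)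
    (hD : IntegrableOn (fun z : RN N × RN N => |u z.1| ^ r * |u z.2| ^ r / ‖z.1 - z.2‖ ^ α)
      (Ω ×ˢ Ω) volume) (hv : AEMeasurable v volume) {C : ℝ} (hC : ∀ x, |v x| ≤ C) :
    ChoquardIntegrable Ω α r u u v := by
  have hC0 : 0 ≤ C := (abs_nonneg _).trans (hC 0)
  refine (integrableOn_choquard_add_const hN hΩb hΩm hα0 hαN hr hu hD hC0).mono'
    (aemeasurable_choquardIntegrand hu hu hv).restrict.aestronglyMeasurable
    (ae_of_all _ fun z => ?_)
  unfold choquardIntegrand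
  rw [Real.norm_eq_abs, abs_div, abs_of_nonneg (Real.rpow_nonneg (norm_nonneg (z.1 - z.2)) α),
    mul_assoc, abs_mul, abs_of_nonneg (Real.rpow_nonneg (abs_nonneg (u z.2)) r), mul_comm]
  gcongr
  · exact abs_spow_mul_le hr (by linarith) (by linarith [hC z.1, abs_nonneg (u z.1)])
  · linarith

end Riesz

/-! ### The variational inequality -/

section Variational

open scoped ENNReal

variable {N : ℕ} {Ω : Set (RN N)} {s p α r : ℝ} {g : RN N → ℝ → ℝ} {H a b u w η : RN N → ℝ}

lemma nonneg_of_hasDerivAt_of_le {J : ℝ → ℝ} {d δ : ℝ} (hJ : HasDerivAt J d 0) (hδ : 0 < δ)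
    (h : ∀ t, 0 < t → t < δ → J 0 ≤ J t) : 0 ≤ d := by
  have ht := (hasDerivWithinAt_iff_tendsto_slope' (s := Set.Ioi (0 : ℝ)) (by simp)).1
    (hJ.hasDerivWithinAt (s := Set.Ioi 0))
  refine ge_of_tendsto ht ?_
  filter_upwards [Ioo_mem_nhdsGT hδ] with t ht
  rw [slope_def_field, sub_zero]
  exact div_nonneg (sub_nonneg.2 (h t ht.1 ht.2)) ht.1.le

lemma abs_add_mul_le {x y t : ℝ} (ht : t ∈ Metric.ball (0 : ℝ) 1) :
    |x + t * y| ≤ |x| + |y| := by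
  have h1 : |t| ≤ 1 := by
    rw [Metric.mem_ball, dist_zero_right, Real.norm_eq_abs] at ht
    exact ht.le
  refine (abs_add_le _ _).trans ?_
  rw [abs_mul]
  nlinarith [abs_nonneg y]

lemma hasDerivAt_gagliardo (hp : 1 < p) (hu : MemW0 Ω s p u) (hη : MemW0 Ω s p η) :
    HasDerivAt (fun t : ℝ => ∫ z : RN N × RN N,
      |(u z.1 + t * η z.1) - (u z.2 + t * η z.2)| ^ p / ‖z.1 - z.2‖ ^ ((N : ℝ) + p * s) / p)
      (fracPLap s p u η) 0 := by
  have heq : ∀ (t : ℝ) (z : RN N × RN N), (u z.1 + t * η z.1) - (u z.2 + t * η z.2) =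
    (u z.1 - u z.2) + t * (η z.1 - η z.2) := fun t z => by ring
  have hM : ∀ t : ℝ, MemW0 Ω s p fun x => u x + t * η x := fun t => hu.add hp (hη.const_mul t)
  have key := hasDerivAt_integral_of_dominated_loc_of_deriv_le
    (μ := (volume : Measure (RN N × RN N)))
    (F := fun (t : ℝ) (z : RN N × RN N) =>
      |(u z.1 + t * η z.1) - (u z.2 + t * η z.2)| ^ p / ‖z.1 - z.2‖ ^ ((N : ℝ) + p * s) / p)
    (F' := fun (t : ℝ) (z : RN N × RN N) =>
      spow ((u z.1 - u z.2) + t * (η z.1 - η z.2)) (p - 1) * (η z.1 - η z.2) /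
        ‖z.1 - z.2‖ ^ ((N : ℝ) + p * s))
    (bound := fun z => 2 ^ p * (|u z.1 - u z.2| ^ p / ‖z.1 - z.2‖ ^ ((N : ℝ) + p * s) +
      |η z.1 - η z.2| ^ p / ‖z.1 - z.2‖ ^ ((N : ℝ) + p * s)))
    (x₀ := (0 : ℝ)) (Metric.ball_mem_nhds (0 : ℝ) one_pos)
    (Eventually.of_forall fun t => ((hM t).gagliardo.div_const p).aestronglyMeasurable)
    ((hM 0).gagliardo.div_const p) ?_ ?_ ((hu.gagliardo.add hη.gagliardo).const_mul _) ?_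
  · simpa [fracPLap] using key.2
  · simpa using (integrable_fracPLap hp hu hη).aestronglyMeasurable
  · refine ae_of_all _ fun z t ht => ?_
    rw [Real.norm_eq_abs, abs_div, abs_of_nonneg (Real.rpow_nonneg (norm_nonneg (z.1 - z.2)) _),
      ← add_div, ← mul_div_assoc]
    gcongr
    exact (abs_spow_mul_le hp (abs_add_mul_le ht) (by linarith [abs_nonneg (u z.1 - u z.2)])).trans
      (rpow_add_le_two_rpow_mul (by linarith) (abs_nonneg _) (abs_nonneg _))
  · refine ae_of_all _ fun z t _ => ?_
    simp only [heq]
    have h := ((hasDerivAt_abs_rpow_add_mul hp (u z.1 - u z.2) (η z.1 - η z.2) t).div_const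
      (‖z.1 - z.2‖ ^ ((N : ℝ) + p * s))).div_const p
    refine h.congr_deriv ?_
    have : p ≠ 0 := by linarith
    field_simp

lemma hasDerivAt_choquard (hN : 2 ≤ N) (hΩb : Bornology.IsBounded Ω)
    (hΩm : MeasurableSet Ω) (hα0 : 0 < α) (hαN : α < N) (hr : 1 < r) (hu : AEMeasurable u volume)
    (hD : IntegrableOn (fun z : RN N × RN N => |u z.1| ^ r * |u z.2| ^ r / ‖z.1 - z.2‖ ^ α)
      (Ω ×ˢ Ω) volume) (hη : AEMeasurable η volume) {C : ℝ} (hC : ∀ x, |η x| ≤ C) :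
    HasDerivAt (fun t : ℝ => ∫ z in Ω ×ˢ Ω,
      |u z.1 + t * η z.1| ^ r * |u z.2 + t * η z.2| ^ r / ‖z.1 - z.2‖ ^ α / (2 * r))
      (choquard Ω α r u u η) 0 := by
  have hC0 : 0 ≤ C := (abs_nonneg _).trans (hC 0)
  have hm : ∀ t : ℝ, AEMeasurable (fun x => u x + t * η x) volume := fun t =>
    hu.add (hη.const_mul t)
  have hc := choquardIntegrable_of_bounded hN hΩb hΩm hα0 hαN hr hu hD hη hC
  have hc' := integrableOn_swap hc
  have key := hasDerivAt_integral_of_dominated_loc_of_deriv_le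
    (μ := (volume : Measure (RN N × RN N)).restrict (Ω ×ˢ Ω))
    (F := fun (t : ℝ) (z : RN N × RN N) =>
      |u z.1 + t * η z.1| ^ r * |u z.2 + t * η z.2| ^ r / ‖z.1 - z.2‖ ^ α / (2 * r))
    (F' := fun (t : ℝ) (z : RN N × RN N) =>
      (spow (u z.1 + t * η z.1) (r - 1) * η z.1 * |u z.2 + t * η z.2| ^ r +
        |u z.1 + t * η z.1| ^ r * (spow (u z.2 + t * η z.2) (r - 1) * η z.2)) /
        ‖z.1 - z.2‖ ^ α / 2)
    (bound := fun z => (|u z.1| + C) ^ r * (|u z.2| + C) ^ r / ‖z.1 - z.2‖ ^ α)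
    (x₀ := (0 : ℝ)) (Metric.ball_mem_nhds (0 : ℝ) one_pos)
    (Eventually.of_forall fun t => ((aemeasurable_choquard_density
      Measure.restrict_le_self.absolutelyContinuous (hm t)).div_const _).aestronglyMeasurable)
    (by simpa using hD.div_const (2 * r)) ?_ ?_
    (integrableOn_choquard_add_const hN hΩb hΩm hα0 hαN hr hu hD hC0) ?_
  · refine key.2.congr_deriv ?_
    have h2 : ∫ z in Ω ×ˢ Ω, choquardIntegrand α r u u η z.swap = choquard Ω α r u u η :=
      integral_swap_square _
    have h3 : choquard Ω α r u u η = ∫ z in Ω ×ˢ Ω,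
        (choquardIntegrand α r u u η z + choquardIntegrand α r u u η z.swap) / 2 := by
      rw [integral_div, integral_add hc hc', h2]
      unfold choquard; ring
    rw [h3]
    congr 1
    ext z
    simp only [choquardIntegrand, Prod.fst_swap, Prod.snd_swap, zero_mul, add_zero]
    rw [norm_sub_rev z.2 z.1]; ring
  · refine ((hc.add hc').div_const 2).aestronglyMeasurable.congr (ae_of_all _ fun z => ?_)
    simp only [choquardIntegrand, Prod.fst_swap, Prod.snd_swap, zero_mul, add_zero, Pi.add_apply]
    rw [norm_sub_rev z.2 z.1]; ring
  · refine ae_of_all _ fun z t ht => ?_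
    have hle : ∀ x, |u x + t * η x| ≤ |u x| + C := fun x =>
      (abs_add_mul_le ht).trans (by linarith [hC x])
    have hle' : ∀ x, |η x| ≤ |u x| + C := fun x => by linarith [hC x, abs_nonneg (u x)]
    have hb1 : ∀ x, |spow (u x + t * η x) (r - 1) * η x| ≤ (|u x| + C) ^ r := fun x =>
      abs_spow_mul_le hr (hle x) (hle' x)
    have hb2 : ∀ x, |u x + t * η x| ^ r ≤ (|u x| + C) ^ r := fun x =>
      Real.rpow_le_rpow (abs_nonneg _) (hle x) (by linarith)
    have hsum : |spow (u z.1 + t * η z.1) (r - 1) * η z.1 * |u z.2 + t * η z.2| ^ r +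
        |u z.1 + t * η z.1| ^ r * (spow (u z.2 + t * η z.2) (r - 1) * η z.2)| ≤
        2 * ((|u z.1| + C) ^ r * (|u z.2| + C) ^ r) := by
      refine (abs_add_le _ _).trans ?_
      rw [abs_mul _ (|u z.2 + t * η z.2| ^ r), abs_mul (|u z.1 + t * η z.1| ^ r),
        abs_of_nonneg (Real.rpow_nonneg (abs_nonneg (u z.2 + t * η z.2)) r),
        abs_of_nonneg (Real.rpow_nonneg (abs_nonneg (u z.1 + t * η z.1)) r), two_mul]
      have hpow := fun x => Real.rpow_nonneg (add_nonneg (abs_nonneg (u x)) hC0) r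
      exact add_le_add
        (mul_le_mul (hb1 _) (hb2 _) (Real.rpow_nonneg (abs_nonneg _) r) (hpow _))
        (mul_le_mul (hb2 _) (hb1 _) (abs_nonneg _) (hpow _))
    rw [Real.norm_eq_abs, abs_div, abs_div,
      abs_of_nonneg (Real.rpow_nonneg (norm_nonneg (z.1 - z.2)) _), abs_two, div_right_comm]
    gcongr
    linarith
  · refine ae_of_all _ fun z t _ => ?_
    have h := (((hasDerivAt_abs_rpow_add_mul hr (u z.1) (η z.1) t).mul
      (hasDerivAt_abs_rpow_add_mul hr (u z.2) (η z.2) t)).div_const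
      (‖z.1 - z.2‖ ^ α)).div_const (2 * r)
    refine h.congr_deriv ?_
    have : r ≠ 0 := by linarith
    field_simp

lemma hasDerivAt_reaction (hm : ∀ t, Measurable fun x => g x t)
    (hc : ∀ x, Continuous (g x)) (hH : Measurable H) (hb : Measurable b)
    (hgH : ∀ x t, |g x t| ≤ H x) (hHb : IntegrableOn (fun x => H x * b x) Ω volume)
    (hHη : IntegrableOn (fun x => H x * η x) Ω volume)
    (hu : AEMeasurable u volume) (hη : AEMeasurable η volume)
    (hub : ∀ᵐ x ∂(volume.restrict Ω), |u x| ≤ b x) :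
    HasDerivAt (fun t : ℝ => ∫ x in Ω, (H x * b x - primitive g x (u x + t * η x)))
      (-∫ x in Ω, g x (u x) * η x) 0 := by
  have hH0 : ∀ x, 0 ≤ H x := fun x => (abs_nonneg _).trans (hgH x 0)
  have hmt : ∀ t : ℝ, AEMeasurable (fun x => H x * b x - primitive g x (u x + t * η x))
      (volume.restrict Ω) := fun t =>
    (hH.mul hb).aemeasurable.sub
      (aemeasurable_comp_primitive hm hc (hu.add (hη.const_mul t)).restrict)
  have key := hasDerivAt_integral_of_dominated_loc_of_deriv_le (μ := volume.restrict Ω)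
    (F := fun (t : ℝ) x => H x * b x - primitive g x (u x + t * η x))
    (F' := fun (t : ℝ) x => -(g x (u x + t * η x) * η x))
    (bound := fun x => |H x * η x|) (x₀ := (0 : ℝ)) (Metric.ball_mem_nhds (0 : ℝ) one_pos)
    (Eventually.of_forall fun t => (hmt t).aestronglyMeasurable) ?_ ?_ ?_ hHη.abs ?_
  · simpa [integral_neg] using key.2
  · refine (hHb.const_mul 2).mono' (hmt 0).aestronglyMeasurable ?_
    filter_upwards [hub] with x hx
    have h1 := abs_le.1 (abs_primitive_le hgH x (u x))
    have h2 : H x * |u x| ≤ H x * b x := mul_le_mul_of_nonneg_left hx (hH0 x)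
    have h3 : 0 ≤ H x * |u x| := mul_nonneg (hH0 x) (abs_nonneg _)
    rw [zero_mul, add_zero, Real.norm_eq_abs, abs_le]
    constructor <;> linarith [h1.1, h1.2]
  · simp only [zero_mul, add_zero]
    exact ((aemeasurable_comp_caratheodory hm hc hu.restrict).mul
      hη.restrict).neg.aestronglyMeasurable
  · refine ae_of_all _ fun x t _ => ?_
    rw [norm_neg, Real.norm_eq_abs, abs_mul, abs_mul, abs_of_nonneg (hH0 x)]
    exact mul_le_mul_of_nonneg_right (hgH x _) (abs_nonneg _)
  · refine ae_of_all _ fun x t _ => ?_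
    have h1 : HasDerivAt (fun t => u x + t * η x) (η x) t := by
      simpa using ((hasDerivAt_id t).mul_const (η x)).const_add (u x)
    exact ((hasDerivAt_primitive hc x _).comp t h1).const_sub _

/-- The energy as a real number, for functions whose three energy integrals converge. -/
lemma energy_eq_ofReal (hp : 1 < p) (hr : 1 < r) (hm : ∀ t, Measurable fun x => g x t)
    (hc : ∀ x, Continuous (g x)) (hgH : ∀ x t, |g x t| ≤ H x)
    (hHb : IntegrableOn (fun x => H x * b x) Ω volume) (hw : MemW0 Ω s p w)
    (hD : IntegrableOn (fun z : RN N × RN N => |w z.1| ^ r * |w z.2| ^ r / ‖z.1 - z.2‖ ^ α)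
      (Ω ×ˢ Ω) volume) (hwb : ∀ᵐ x ∂(volume.restrict Ω), |w x| ≤ b x) :
    0 ≤ (∫ z : RN N × RN N,
        |w z.1 - w z.2| ^ p / ‖z.1 - z.2‖ ^ ((N : ℝ) + p * s) / p) +
      (∫ z in Ω ×ˢ Ω, |w z.1| ^ r * |w z.2| ^ r / ‖z.1 - z.2‖ ^ α / (2 * r)) +
      (∫ x in Ω, (H x * b x - primitive g x (w x))) ∧
    energy Ω s p α r g H b w = ENNReal.ofReal ((∫ z : RN N × RN N,
        |w z.1 - w z.2| ^ p / ‖z.1 - z.2‖ ^ ((N : ℝ) + p * s) / p) +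
      (∫ z in Ω ×ˢ Ω, |w z.1| ^ r * |w z.2| ^ r / ‖z.1 - z.2‖ ^ α / (2 * r)) +
      ∫ x in Ω, (H x * b x - primitive g x (w x))) := by
  have hH0 : ∀ x, 0 ≤ H x := fun x => (abs_nonneg _).trans (hgH x 0)
  have hΦb : ∀ᵐ x ∂(volume.restrict Ω), |primitive g x (w x)| ≤ H x * b x := by
    filter_upwards [hwb] with x hx
    exact (abs_primitive_le hgH x (w x)).trans (mul_le_mul_of_nonneg_left hx (hH0 x))
  have h1 : 0 ≤ᵐ[volume] fun z : RN N × RN N =>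
      |w z.1 - w z.2| ^ p / ‖z.1 - z.2‖ ^ ((N : ℝ) + p * s) / p := ae_of_all _ fun z => by
    have : 0 < p := by linarith
    simp only [Pi.zero_apply]; positivity
  have h2 : 0 ≤ᵐ[volume.restrict (Ω ×ˢ Ω)] fun z : RN N × RN N =>
      |w z.1| ^ r * |w z.2| ^ r / ‖z.1 - z.2‖ ^ α / (2 * r) := ae_of_all _ fun z => by
    have : 0 < r := by linarith
    simp only [Pi.zero_apply]; positivity
  have h3 : 0 ≤ᵐ[volume.restrict Ω] fun x => H x * b x - primitive g x (w x) := by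
    filter_upwards [hΦb] with x hx
    simp only [Pi.zero_apply]; linarith [(abs_le.1 hx).2]
  have i3 : IntegrableOn (fun x => H x * b x - primitive g x (w x)) Ω volume :=
    hHb.sub (hHb.mono' (aemeasurable_comp_primitive hm hc
      hw.aemeasurable.restrict).aestronglyMeasurable hΦb)
  have n1 := integral_nonneg_of_ae h1
  have n2 := integral_nonneg_of_ae h2
  have n3 := integral_nonneg_of_ae h3
  refine ⟨by positivity, ?_⟩
  rw [ENNReal.ofReal_add (by positivity) n3, ENNReal.ofReal_add n1 n2,
    ofReal_integral_eq_lintegral_ofReal (hw.gagliardo.div_const p) h1,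
    ofReal_integral_eq_lintegral_ofReal (hD.div_const _) h2,
    ofReal_integral_eq_lintegral_ofReal i3 h3]
  rfl

/-- Functions of finite energy in the order interval belong to `W_0^{s,p}(Ω)` and have finite
Choquard energy. -/
lemma OrderInterval.of_energy_ne_top (hp : 1 < p) (hr : 1 < r) (hu : OrderInterval a b u)
    (h0a : ∀ x, 0 ≤ a x) (hbW : MemW0 Ω s p b) (haW : MemW0 Ω s p a)
    (hE : energy Ω s p α r g H b u ≠ ⊤) :
    MemW0 Ω s p u ∧
    IntegrableOn (fun z : RN N × RN N => |u z.1| ^ r * |u z.2| ^ r / ‖z.1 - z.2‖ ^ α)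
      (Ω ×ˢ Ω) volume := by
  have h12 := ENNReal.add_ne_top.1 (ENNReal.add_ne_top.1 hE).1
  have hp0 : p ≠ 0 := by linarith
  have hr0 : 2 * r ≠ 0 := by linarith
  refine ⟨⟨hbW.memLp.mono hu.1.aestronglyMeasurable ?_, ?_, ?_⟩, ?_⟩
  · filter_upwards [hu.2] with x hx
    rw [Real.norm_of_nonneg ((h0a x).trans hx.1)]
    exact hx.2.trans (le_abs_self _)
  · have h : Integrable (fun z : RN N × RN N =>
        |u z.1 - u z.2| ^ p / ‖z.1 - z.2‖ ^ ((N : ℝ) + p * s) / p) volume :=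
      (lintegral_ofReal_ne_top_iff_integrable
        ((aemeasurable_gagliardo hu.1).div_const p).aestronglyMeasurable
        (ae_of_all _ fun z => by
          have : 0 < p := by linarith
          simp only [Pi.zero_apply]; positivity)).1 h12.1
    simpa only [div_mul_cancel₀ _ hp0] using h.mul_const p
  · filter_upwards [hu.2, haW.eq_zero, hbW.eq_zero] with x hx h1 h2 hxΩ
    exact le_antisymm (hx.2.trans (h2 hxΩ).le) ((h1 hxΩ).ge.trans hx.1)
  · have h : IntegrableOn (fun z : RN N × RN N =>
        |u z.1| ^ r * |u z.2| ^ r / ‖z.1 - z.2‖ ^ α / (2 * r)) (Ω ×ˢ Ω) volume :=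
      (lintegral_ofReal_ne_top_iff_integrable
        ((aemeasurable_choquard_density Measure.restrict_le_self.absolutelyContinuous
          hu.1).div_const _).aestronglyMeasurable
        (ae_of_all _ fun z => by
          have : 0 < r := by linarith
          simp only [Pi.zero_apply]; positivity)).1 h12.2
    have h' := h.mul_const (2 * r)
    simp only [div_mul_cancel₀ _ hr0] at h'
    exact h'

/-- First-order optimality of an energy minimiser in bounded directions that stay for a short time
inside the order interval. -/
theorem variational_inequality (hN : 2 ≤ N) (hΩb : Bornology.IsBounded Ω)
    (hΩm : MeasurableSet Ω) (hp : 1 < p) (hα0 : 0 < α) (hαN : α < N) (hr : 1 < r)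
    (hm : ∀ t, Measurable fun x => g x t)
    (hc : ∀ x, Continuous (g x)) (hH : Measurable H) (hb : Measurable b)
    (hgH : ∀ x t, |g x t| ≤ H x)
    (hHint : ∀ v, MemW0 Ω s p v → IntegrableOn (fun x => H x * v x) Ω volume)
    (h0a : ∀ x, 0 ≤ a x) (hbW : MemW0 Ω s p b) (huM : OrderInterval a b u)
    (huW : MemW0 Ω s p u)
    (hD : IntegrableOn (fun z : RN N × RN N => |u z.1| ^ r * |u z.2| ^ r / ‖z.1 - z.2‖ ^ α)
      (Ω ×ˢ Ω) volume)
    (hmin : ∀ w, OrderInterval a b w → energy Ω s p α r g H b u ≤ energy Ω s p α r g H b w)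
    (hη : MemW0 Ω s p η) {C : ℝ} (hC : ∀ x, |η x| ≤ C) {δ : ℝ} (hδ : 0 < δ)
    (hηM : ∀ t, 0 < t → t < δ → OrderInterval a b fun x => u x + t * η x) :
    ∫ x in Ω, g x (u x) * η x ≤ fracPLap s p u η + choquard Ω α r u u η := by
  have habs : ∀ {w}, OrderInterval a b w → ∀ᵐ x ∂(volume.restrict Ω), |w x| ≤ b x := by
    intro w hw
    filter_upwards [ae_restrict_of_ae hw.2] with x hx
    rw [abs_of_nonneg ((h0a x).trans hx.1)]
    exact hx.2
  have hHb := hHint b hbW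
  have hC0 : 0 ≤ C := (abs_nonneg _).trans (hC 0)
  have hJ := ((hasDerivAt_gagliardo hp huW hη).add
    (hasDerivAt_choquard hN hΩb hΩm hα0 hαN hr huM.1 hD hη.aemeasurable hC)).add
    (hasDerivAt_reaction hm hc hH hb hgH hHb (hHint η hη) huM.1 hη.aemeasurable (habs huM))
  have key := nonneg_of_hasDerivAt_of_le hJ (lt_min hδ one_pos) fun t ht0 ht => ?_
  · linarith
  · have htM := hηM t ht0 (ht.trans_le (min_le_left _ _))
    have hDt : IntegrableOn (fun z : RN N × RN N => |u z.1 + t * η z.1| ^ r *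
        |u z.2 + t * η z.2| ^ r / ‖z.1 - z.2‖ ^ α) (Ω ×ˢ Ω) volume := by
      refine (integrableOn_choquard_add_const hN hΩb hΩm hα0 hαN hr huM.1 hD hC0).mono'
        (aemeasurable_choquard_density Measure.restrict_le_self.absolutelyContinuous
          htM.1).aestronglyMeasurable (ae_of_all _ fun z => ?_)
      have hle : ∀ x, |u x + t * η x| ≤ |u x| + C := fun x =>
        (abs_add_mul_le (by
          rw [Metric.mem_ball, dist_zero_right, Real.norm_of_nonneg ht0.le]
          exact ht.trans_le (min_le_right _ _))).trans (by linarith [hC x])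
      rw [Real.norm_of_nonneg (by positivity)]
      gcongr
      · exact hle _
      · exact hle _
    have e0 := energy_eq_ofReal hp hr hm hc hgH hHb huW hD (habs huM)
    have e1 := energy_eq_ofReal hp hr hm hc hgH hHb (huW.add hp (hη.const_mul t)) hDt (habs htM)
    have hle := hmin _ htM
    rw [e0.2, e1.2, ENNReal.ofReal_le_ofReal_iff e1.1] at hle
    simpa using hle

end Variational

/-! ### From the minimiser to a weak solution -/

section Solution

open scoped ENNReal

variable {N : ℕ} {Ω : Set (RN N)} {s p α r : ℝ} {g : RN N → ℝ → ℝ} {H a b u v φ : RN N → ℝ}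

/-- The problem after truncation of the reaction to the order interval `[a, b]`: `g` is a
Carathéodory function dominated by a weight `H` that is integrable against `W_0^{s,p}(Ω)`, `b` is a
strong supersolution, and `a` is a uniform subsolution relative to `b`, with `0 ≤ a ≤ b` everywhere
and not only almost everywhere. -/
structure TruncatedProblem (Ω : Set (RN N)) (s p α r : ℝ) (g : RN N → ℝ → ℝ)
    (H a b : RN N → ℝ) : Prop where
  two_le : 2 ≤ N
  bounded : Bornology.IsBounded Ω
  measurableSet : MeasurableSet Ω
  s_pos : 0 < s
  one_lt_p : 1 < p
  α_pos : 0 < α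
  α_lt : α < N
  one_lt_r : 1 < r
  measurable_g : ∀ t, Measurable fun x => g x t
  continuous_g : ∀ x, Continuous (g x)
  measurable_H : Measurable H
  abs_g_le : ∀ x t, |g x t| ≤ H x
  integrable_H : ∀ v, MemW0 Ω s p v → IntegrableOn (fun x => H x * v x) Ω volume
  measurable_b : Measurable b
  nonneg : ∀ x, 0 ≤ a x
  le : ∀ x, a x ≤ b x
  memW0_a : MemW0 Ω s p a
  memW0_b : MemW0 Ω s p b
  super : ∀ v, MemW0Pos Ω s p v → ∫ x in Ω, g x (b x) * v x ≤ fracPLap s p b v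
  sub : ∀ v, MemW0Pos Ω s p v → ChoquardIntegrable Ω α r b a v ∧
    fracPLap s p a v ≤ (∫ x in Ω, g x (a x) * v x) - choquard Ω α r b a v

/-- A minimiser of the energy over the order interval `[a, b]`. -/
structure EnergyMinimizer (Ω : Set (RN N)) (s p α r : ℝ) (g : RN N → ℝ → ℝ)
    (H a b u : RN N → ℝ) : Prop where
  memW0 : MemW0 Ω s p u
  mem : ∀ x, a x ≤ u x ∧ u x ≤ b x
  finite : IntegrableOn (fun z : RN N × RN N => |u z.1| ^ r * |u z.2| ^ r / ‖z.1 - z.2‖ ^ α)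
    (Ω ×ˢ Ω) volume
  energy_le : ∀ w, OrderInterval a b w → energy Ω s p α r g H b u ≤ energy Ω s p α r g H b w

namespace TruncatedProblem

lemma integrableOn_reaction (P : TruncatedProblem Ω s p α r g H a b) {w : RN N → ℝ}
    (hw : AEMeasurable w volume) (hv : MemW0 Ω s p v) :
    IntegrableOn (fun x => g x (w x) * v x) Ω volume := by
  refine Integrable.mono (P.integrable_H v hv)
    ((aemeasurable_comp_caratheodory P.measurable_g P.continuous_g hw.restrict).mul
      hv.aemeasurable.restrict).aestronglyMeasurable (ae_of_all _ fun x => ?_)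
  rw [norm_mul, norm_mul]
  gcongr
  exact (P.abs_g_le x (w x)).trans (le_abs_self _)

/-- The energy is finite at the subsolution: its Choquard energy is dominated by the integral in
the definition of a uniform subsolution, tested with the subsolution itself. -/
lemma energy_ne_top (P : TruncatedProblem Ω s p α r g H a b) :
    energy Ω s p α r g H b a ≠ ⊤ := by
  have hr := P.one_lt_r
  have hD : IntegrableOn (fun z : RN N × RN N => |a z.1| ^ r * |a z.2| ^ r / ‖z.1 - z.2‖ ^ α)
      (Ω ×ˢ Ω) volume := by
    refine (P.sub a ⟨P.memW0_a, ae_of_all _ P.nonneg⟩).1.mono'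
      (aemeasurable_choquard_density Measure.restrict_le_self.absolutelyContinuous
        P.memW0_a.aemeasurable).aestronglyMeasurable (ae_of_all _ fun z => ?_)
    rw [Real.norm_of_nonneg (by positivity)]
    unfold choquardIntegrand
    have h1 : |a z.1| ^ r = spow (a z.1) (r - 1) * a z.1 := by
      have h := abs_mul (spow (a z.1) (r - 1)) (a z.1)
      rw [abs_spow (by linarith)] at h
      have hnn : 0 ≤ spow (a z.1) (r - 1) * a z.1 := by
        rw [spow_of_nonneg (by linarith) (P.nonneg _)]
        exact mul_nonneg (Real.rpow_nonneg (P.nonneg _) _) (P.nonneg _)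
      rw [abs_of_nonneg hnn] at h
      rw [h]
      rcases (abs_nonneg (a z.1)).eq_or_lt with h0 | h0
      · rw [← h0, mul_zero, Real.zero_rpow (by linarith)]
      · rw [← Real.rpow_add_one h0.ne']; simp
    rw [mul_assoc, ← h1, mul_comm]
    have h2 : |a z.2| ≤ |b z.2| := by
      rw [abs_of_nonneg (P.nonneg _), abs_of_nonneg ((P.nonneg _).trans (P.le _))]
      exact P.le _
    gcongr
  rw [(energy_eq_ofReal P.one_lt_p hr P.measurable_g P.continuous_g P.abs_g_le
    (P.integrable_H b P.memW0_b) P.memW0_a hD (ae_of_all _ fun x => by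
      rw [abs_of_nonneg (P.nonneg x)]; exact P.le x)).2]
  exact ENNReal.ofReal_ne_top

lemma exists_minimizer (P : TruncatedProblem Ω s p α r g H a b) :
    ∃ u, EnergyMinimizer Ω s p α r g H a b u := by
  obtain ⟨u, hum, hu, hmin⟩ := exists_energy_minimizer (α := α) P.s_pos P.one_lt_p P.one_lt_r
    P.measurableSet P.bounded.measure_lt_top.ne P.measurable_g P.continuous_g P.measurable_H
    P.measurable_b P.nonneg P.le P.memW0_a P.memW0_b P.energy_ne_top
  have haM : OrderInterval a b a :=
    ⟨P.memW0_a.aemeasurable, ae_of_all _ fun x => ⟨le_rfl, P.le x⟩⟩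
  have huM : OrderInterval a b u := ⟨hum, ae_of_all _ hu⟩
  obtain ⟨h1, h2⟩ := huM.of_energy_ne_top P.one_lt_p P.one_lt_r P.nonneg P.memW0_b P.memW0_a
    (ne_top_of_le_ne_top P.energy_ne_top (hmin a haM))
  exact ⟨u, h1, hu, h2, hmin⟩

end TruncatedProblem

namespace EnergyMinimizer

lemma nonneg (P : TruncatedProblem Ω s p α r g H a b)
    (M : EnergyMinimizer Ω s p α r g H a b u) (x : RN N) : 0 ≤ u x :=
  (P.nonneg x).trans (M.mem x).1

lemma choquardIntegrable (P : TruncatedProblem Ω s p α r g H a b)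
    (M : EnergyMinimizer Ω s p α r g H a b u) (hv : AEMeasurable v volume) {C : ℝ}
    (hC : ∀ x, |v x| ≤ C) : ChoquardIntegrable Ω α r u u v :=
  choquardIntegrable_of_bounded P.two_le P.bounded P.measurableSet P.α_pos P.α_lt P.one_lt_r
    M.memW0.aemeasurable M.finite hv hC

lemma variational (P : TruncatedProblem Ω s p α r g H a b)
    (M : EnergyMinimizer Ω s p α r g H a b u) {η : RN N → ℝ} (hη : MemW0 Ω s p η) {C : ℝ}
    (hC : ∀ x, |η x| ≤ C) {δ : ℝ} (hδ : 0 < δ)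
    (hηM : ∀ t, 0 < t → t < δ → ∀ x, a x ≤ u x + t * η x ∧ u x + t * η x ≤ b x) :
    ∫ x in Ω, g x (u x) * η x ≤ fracPLap s p u η + choquard Ω α r u u η :=
  variational_inequality P.two_le P.bounded P.measurableSet P.one_lt_p P.α_pos P.α_lt P.one_lt_r
    P.measurable_g P.continuous_g P.measurable_H P.measurable_b P.abs_g_le P.integrable_H P.nonneg
    P.memW0_b ⟨M.memW0.aemeasurable, ae_of_all _ M.mem⟩ M.memW0 M.finite M.energy_le hη hC hδ
    fun t h0 h1 => ⟨M.memW0.aemeasurable.add (hη.aemeasurable.const_mul t),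
      ae_of_all _ (hηM t h0 h1)⟩

end EnergyMinimizer

lemma choquard_sub {v w : RN N → ℝ} (hv : ChoquardIntegrable Ω α r a u v)
    (hw : ChoquardIntegrable Ω α r a u w) :
    choquard Ω α r a u (fun x => v x - w x) = choquard Ω α r a u v - choquard Ω α r a u w := by
  unfold choquard
  rw [← integral_sub hv hw]
  congr 1; ext z; unfold choquardIntegrand; ring

lemma choquard_const_mul (c : ℝ) :
    choquard Ω α r a u (fun x => c * v x) = c * choquard Ω α r a u v := by
  unfold choquard
  rw [← integral_const_mul]
  congr 1; ext z; unfold choquardIntegrand; ring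

lemma choquardIntegrand_nonneg (hr : 1 < r) {z : RN N × RN N} (hu : 0 ≤ u z.1) (hv : 0 ≤ v z.1) :
    0 ≤ choquardIntegrand α r a u v z := by
  unfold choquardIntegrand
  rw [spow_of_nonneg (by linarith) hu]
  positivity

/-- On cut-off functions that concentrate on the contact set `{w = u}`, the reaction terms at `w`
and at `u` have the same limit. -/
lemma TruncatedProblem.tendsto_reaction_cut (P : TruncatedProblem Ω s p α r g H a b)
    {w e : RN N → ℝ} (hu : AEMeasurable u volume) (hw : AEMeasurable w volume)
    (he : MemW0 Ω s p e) (he0 : ∀ x, 0 ≤ e x) (hcontact : ∀ x, e x = 0 → w x = u x)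
    (hφ : MemW0 Ω s p φ) (hφ0 : ∀ x, 0 ≤ φ x) :
    Tendsto (fun n => (∫ x in Ω, g x (w x) * cut φ e n x) - ∫ x in Ω, g x (u x) * cut φ e n x)
      atTop (𝓝 0) := by
  have hχ := fun n => hφ.cut P.one_lt_p he n
  have heq : ∀ n, (∫ x in Ω, g x (w x) * cut φ e n x) - ∫ x in Ω, g x (u x) * cut φ e n x =
      ∫ x in Ω, (g x (w x) * cut φ e n x - g x (u x) * cut φ e n x) := fun n =>
    (integral_sub (P.integrableOn_reaction hw (hχ n)) (P.integrableOn_reaction hu (hχ n))).symm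
  simp_rw [heq]
  suffices h : Tendsto (fun n => ∫ x in Ω, (g x (w x) * cut φ e n x - g x (u x) * cut φ e n x))
      atTop (𝓝 (∫ _ in Ω, (0 : ℝ))) by simpa using h
  refine tendsto_integral_of_dominated_convergence (fun x => 2 * (H x * φ x))
    (fun n => ((P.integrableOn_reaction hw (hχ n)).sub
      (P.integrableOn_reaction hu (hχ n))).aestronglyMeasurable)
    ((P.integrable_H φ hφ).const_mul 2) (fun n => ae_of_all _ fun x => ?_)
    (ae_of_all _ fun x => ?_)
  · have h0 : 0 ≤ cut φ e n x := cut_nonneg n x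
    have h1 : cut φ e n x ≤ φ x := cut_le (hφ0 x) (he0 x)
    have h2 : |g x (w x) - g x (u x)| ≤ 2 * H x := by
      have := abs_sub (g x (w x)) (g x (u x))
      linarith [P.abs_g_le x (w x), P.abs_g_le x (u x)]
    rw [← sub_mul, Real.norm_eq_abs, abs_mul, abs_of_nonneg h0, ← mul_assoc]
    have h3 : 0 ≤ 2 * H x := (abs_nonneg _).trans h2
    gcongr
  · refine tendsto_const_nhds.congr' ?_
    rcases (he0 x).eq_or_lt with h | h
    · exact Eventually.of_forall fun n => by simp [hcontact x h.symm]
    · filter_upwards [eventually_cut_eq_zero (φ := φ) (e := e) h] with n hn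
      rw [hn]; simp

lemma abs_sub_cut_le {X : Type*} {φ e : X → ℝ} {C : ℝ} {n : ℕ} {x : X} (hφ : 0 ≤ φ x)
    (hC : φ x ≤ C) (he : 0 ≤ e x) : |φ x - cut φ e n x| ≤ C := by
  rw [abs_of_nonneg (sub_nonneg.2 (cut_le hφ he))]
  linarith [cut_nonneg (φ := φ) (e := e) n x]

lemma mul_sub_cut_le {X : Type*} {φ e : X → ℝ} {n : ℕ} {x : X} (he : 0 ≤ e x) {t : ℝ}
    (ht0 : 0 < t) (ht : t < 1 / ((n : ℝ) + 1)) : t * (φ x - cut φ e n x) ≤ e x := by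
  rw [sub_cut_eq_min]
  have h1 : t * n ≤ 1 := by
    rw [lt_div_iff₀ (by positivity)] at ht
    linarith
  calc t * min (φ x) (n * e x) ≤ t * (n * e x) := by gcongr; exact min_le_right _ _
    _ = t * n * e x := by ring
    _ ≤ 1 * e x := by gcongr
    _ = e x := one_mul _

/-- The minimiser is a supersolution, for bounded test functions. The admissible variation is the
test function `φ` minus its cut-off near the contact set with the supersolution; on the cut-off the
supersolution property takes over. -/
lemma EnergyMinimizer.super (P : TruncatedProblem Ω s p α r g H a b)
    (M : EnergyMinimizer Ω s p α r g H a b u) (hφ : MemW0 Ω s p φ) (hφ0 : ∀ x, 0 ≤ φ x) {C : ℝ}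
    (hC : ∀ x, φ x ≤ C) :
    ∫ x in Ω, g x (u x) * φ x ≤ fracPLap s p u φ + choquard Ω α r u u φ := by
  have hp := P.one_lt_p
  set e : RN N → ℝ := fun x => b x - u x with he
  have he0 : ∀ x, 0 ≤ e x := fun x => sub_nonneg.2 (M.mem x).2
  have heW : MemW0 Ω s p e := P.memW0_b.sub hp M.memW0
  have hχ : ∀ n, MemW0 Ω s p (cut φ e n) := fun n => hφ.cut hp heW n
  have hum := M.memW0.aemeasurable
  have hcφ : ChoquardIntegrable Ω α r u u φ :=
    M.choquardIntegrable P hφ.aemeasurable fun x => by rw [abs_of_nonneg (hφ0 x)]; exact hC x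
  have hcχ : ∀ n, ChoquardIntegrable Ω α r u u (cut φ e n) := fun n =>
    M.choquardIntegrable P (hχ n).aemeasurable fun x => by
      rw [abs_of_nonneg (cut_nonneg n x)]
      exact (cut_le (hφ0 x) (he0 x)).trans (hC x)
  obtain ⟨R, hR, hRle⟩ := exists_tendsto_fracPLap_cut hp M.memW0 P.memW0_b
    (ae_of_all _ fun x => (M.mem x).2) hφ
  have hreac := P.tendsto_reaction_cut hum P.memW0_b.aemeasurable heW he0
    (fun x h => sub_eq_zero.1 h) hφ hφ0
  have hlim := hR.add hreac
  rw [add_zero] at hlim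
  have hfin : 0 ≤ fracPLap s p u φ + choquard Ω α r u u φ - ∫ x in Ω, g x (u x) * φ x := by
    refine le_of_tendsto' hlim fun n => ?_
    have hvar := M.variational P (hφ.sub hp (hχ n)) (C := C)
      (fun x => abs_sub_cut_le (hφ0 x) (hC x) (he0 x)) (δ := 1 / ((n : ℝ) + 1)) (by positivity)
      fun t h0 h1 x => by
        have h2 := mul_sub_cut_le (φ := φ) (he0 x) h0 h1
        have h3 : 0 ≤ t * (φ x - cut φ e n x) :=
          mul_nonneg h0.le (sub_nonneg.2 (cut_le (hφ0 x) (he0 x)))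
        have h4 := (M.mem x).1
        simp only [he] at h2 h3 ⊢
        constructor <;> linarith
    rw [fracPLap_sub hp M.memW0 hφ (hχ n), choquard_sub hcφ (hcχ n)] at hvar
    simp_rw [mul_sub] at hvar
    rw [integral_sub (P.integrableOn_reaction hum hφ)
      (P.integrableOn_reaction hum (hχ n))] at hvar
    have hch : 0 ≤ choquard Ω α r u u (cut φ e n) :=
      integral_nonneg fun z => choquardIntegrand_nonneg P.one_lt_r (M.nonneg P _)
        (cut_nonneg n _)
    have hsup := P.super _ ⟨hχ n, ae_of_all _ fun x => cut_nonneg n x⟩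
    linarith [hRle n]
  linarith

/-- Along the cut-offs near the contact set with the subsolution, the Choquard term of the
subsolution, whose nonlocal coefficient is computed from `b ≥ u`, asymptotically dominates the
Choquard term of `u`. -/
lemma EnergyMinimizer.exists_tendsto_choquard_cut (P : TruncatedProblem Ω s p α r g H a b)
    (M : EnergyMinimizer Ω s p α r g H a b u) (hφ : MemW0 Ω s p φ) (hφ0 : ∀ x, 0 ≤ φ x) {C : ℝ}
    (hC : ∀ x, φ x ≤ C) :
    ∃ S : ℕ → ℝ, Tendsto S atTop (𝓝 0) ∧ ∀ n,
      choquard Ω α r u u (cut φ (fun x => u x - a x) n) -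
        choquard Ω α r b a (cut φ (fun x => u x - a x) n) ≤ S n := by
  have hp := P.one_lt_p
  have hr := P.one_lt_r
  set e : RN N → ℝ := fun x => u x - a x with he
  have he0 : ∀ x, 0 ≤ e x := fun x => sub_nonneg.2 (M.mem x).1
  have hχ : ∀ n, MemW0 Ω s p (cut φ e n) := fun n => hφ.cut hp (M.memW0.sub hp P.memW0_a) n
  have hum := M.memW0.aemeasurable
  have hcφ : ChoquardIntegrable Ω α r u u φ :=
    M.choquardIntegrable P hφ.aemeasurable fun x => by rw [abs_of_nonneg (hφ0 x)]; exact hC x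
  have hcχ : ∀ n, ChoquardIntegrable Ω α r u u (cut φ e n) := fun n =>
    M.choquardIntegrable P (hχ n).aemeasurable fun x => by
      rw [abs_of_nonneg (cut_nonneg n x)]
      exact (cut_le (hφ0 x) (he0 x)).trans (hC x)
  have hsub := fun n => (P.sub _ ⟨hχ n, ae_of_all _ fun x => cut_nonneg n x⟩).1
  let T : ℕ → RN N × RN N → ℝ := fun n z =>
    choquardIntegrand α r u u (cut φ e n) z - choquardIntegrand α r u a (cut φ e n) z
  have hTmeas : ∀ n, AEMeasurable (T n) (volume.restrict (Ω ×ˢ Ω)) := fun n =>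
    ((aemeasurable_choquardIntegrand hum hum (hχ n).aemeasurable).sub
      (aemeasurable_choquardIntegrand hum P.memW0_a.aemeasurable (hχ n).aemeasurable)).restrict
  have hTb : ∀ n z, ‖T n z‖ ≤ choquardIntegrand α r u u φ z := by
    intro n z
    have h0 : 0 ≤ cut φ e n z.1 := cut_nonneg n z.1
    have h1 : cut φ e n z.1 ≤ φ z.1 := cut_le (hφ0 _) (he0 _)
    have h2 : spow (a z.1) (r - 1) ≤ spow (u z.1) (r - 1) :=
      spow_mono (by linarith) (M.mem _).1
    have h3 : 0 ≤ spow (a z.1) (r - 1) := by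
      rw [spow_of_nonneg (by linarith) (P.nonneg _)]
      exact Real.rpow_nonneg (P.nonneg _) _
    have h4 : T n z = |u z.2| ^ r * (spow (u z.1) (r - 1) - spow (a z.1) (r - 1)) *
        cut φ e n z.1 / ‖z.1 - z.2‖ ^ α := by
      simp only [T, choquardIntegrand]; ring
    have h5 : 0 ≤ spow (u z.1) (r - 1) - spow (a z.1) (r - 1) := sub_nonneg.2 h2
    rw [h4, Real.norm_of_nonneg (by positivity)]
    unfold choquardIntegrand
    have h6 : 0 ≤ spow (u z.1) (r - 1) := h3.trans h2
    gcongr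
    linarith
  have hTi : ∀ n, Integrable (T n) (volume.restrict (Ω ×ˢ Ω)) := fun n =>
    hcφ.mono' (hTmeas n).aestronglyMeasurable (ae_of_all _ (hTb n))
  refine ⟨fun n => ∫ z in Ω ×ˢ Ω, T n z, ?_, fun n => ?_⟩
  · suffices h : Tendsto (fun n => ∫ z in Ω ×ˢ Ω, T n z) atTop
        (𝓝 (∫ _ in Ω ×ˢ Ω, (0 : ℝ) ∂(volume : Measure (RN N × RN N)))) by simpa using h
    refine tendsto_integral_of_dominated_convergence _
      (fun n => (hTmeas n).aestronglyMeasurable) hcφ (fun n => ae_of_all _ (hTb n))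
      (ae_of_all _ fun z => tendsto_const_nhds.congr' ?_)
    rcases (he0 z.1).eq_or_lt with h | h
    · have : u z.1 = a z.1 := sub_eq_zero.1 h.symm
      exact Eventually.of_forall fun n => by simp [T, choquardIntegrand, this]
    · filter_upwards [eventually_cut_eq_zero (φ := φ) (e := e) h] with n hn
      simp [T, choquardIntegrand, hn]
  · unfold choquard
    rw [← integral_sub (hcχ n) (hsub n)]
    refine integral_mono ((hcχ n).sub (hsub n)) (hTi n) fun z => ?_
    simp only [T]
    refine sub_le_sub_left ?_ _
    unfold choquardIntegrand
    have h3 : 0 ≤ spow (a z.1) (r - 1) := by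
      rw [spow_of_nonneg (by linarith) (P.nonneg _)]
      exact Real.rpow_nonneg (P.nonneg _) _
    have h4 : |u z.2| ≤ |b z.2| := by
      rw [abs_of_nonneg (M.nonneg P _), abs_of_nonneg ((M.nonneg P _).trans (M.mem _).2)]
      exact (M.mem _).2
    have h0 : 0 ≤ cut φ e n z.1 := cut_nonneg n z.1
    gcongr

/-- The minimiser is a subsolution, for bounded test functions. -/
lemma EnergyMinimizer.sub (P : TruncatedProblem Ω s p α r g H a b)
    (M : EnergyMinimizer Ω s p α r g H a b u) (hφ : MemW0 Ω s p φ) (hφ0 : ∀ x, 0 ≤ φ x) {C : ℝ}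
    (hC : ∀ x, φ x ≤ C) :
    fracPLap s p u φ + choquard Ω α r u u φ ≤ ∫ x in Ω, g x (u x) * φ x := by
  have hp := P.one_lt_p
  set e : RN N → ℝ := fun x => u x - a x with he
  have he0 : ∀ x, 0 ≤ e x := fun x => sub_nonneg.2 (M.mem x).1
  have heW : MemW0 Ω s p e := M.memW0.sub hp P.memW0_a
  have hχ : ∀ n, MemW0 Ω s p (cut φ e n) := fun n => hφ.cut hp heW n
  have hum := M.memW0.aemeasurable
  have hcφ : ChoquardIntegrable Ω α r u u φ :=
    M.choquardIntegrable P hφ.aemeasurable fun x => by rw [abs_of_nonneg (hφ0 x)]; exact hC x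
  have hcχ : ∀ n, ChoquardIntegrable Ω α r u u (cut φ e n) := fun n =>
    M.choquardIntegrable P (hχ n).aemeasurable fun x => by
      rw [abs_of_nonneg (cut_nonneg n x)]
      exact (cut_le (hφ0 x) (he0 x)).trans (hC x)
  obtain ⟨R, hR, hRle⟩ := exists_tendsto_fracPLap_cut hp P.memW0_a M.memW0
    (ae_of_all _ fun x => (M.mem x).1) hφ
  obtain ⟨S, hS, hSle⟩ := M.exists_tendsto_choquard_cut P hφ hφ0 hC
  have hreac := P.tendsto_reaction_cut hum P.memW0_a.aemeasurable heW he0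
    (fun x h => (sub_eq_zero.1 h).symm) hφ hφ0
  have hlim := (hS.sub hR).add hreac
  rw [sub_zero, add_zero] at hlim
  have hfin : fracPLap s p u φ + choquard Ω α r u u φ - ∫ x in Ω, g x (u x) * φ x ≤ 0 := by
    refine ge_of_tendsto' hlim fun n => ?_
    have hvar := M.variational P ((hφ.sub hp (hχ n)).const_mul (-1)) (C := C)
      (fun x => by
        rw [abs_mul, abs_neg, abs_one, one_mul]
        exact abs_sub_cut_le (hφ0 x) (hC x) (he0 x)) (δ := 1 / ((n : ℝ) + 1)) (by positivity)
      fun t h0 h1 x => by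
        have h2 := mul_sub_cut_le (φ := φ) (he0 x) h0 h1
        have h3 : 0 ≤ t * (φ x - cut φ e n x) :=
          mul_nonneg h0.le (sub_nonneg.2 (cut_le (hφ0 x) (he0 x)))
        have h4 := (M.mem x).2
        simp only [he] at h2 h3 ⊢
        constructor <;> linarith
    rw [fracPLap_const_mul, fracPLap_sub hp M.memW0 hφ (hχ n), choquard_const_mul,
      choquard_sub hcφ (hcχ n)] at hvar
    have hint : ∫ x in Ω, g x (u x) * (-1 * (φ x - cut φ e n x)) =
        (∫ x in Ω, g x (u x) * cut φ e n x) - ∫ x in Ω, g x (u x) * φ x := by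
      rw [← integral_sub (P.integrableOn_reaction hum (hχ n)) (P.integrableOn_reaction hum hφ)]
      congr 1; ext x; ring
    rw [hint] at hvar
    have hsub := (P.sub _ ⟨hχ n, ae_of_all _ fun x => cut_nonneg n x⟩).2
    linarith [hRle n, hSle n]
  linarith

/-- Bounded truncations `min |v| n` of a test function. -/
lemma MemW0.min_abs (hp : 1 < p) (hv : MemW0 Ω s p v) (n : ℕ) :
    MemW0 Ω s p fun x => min |v x| n := by
  refine hv.of_le hp hv ((measurable_norm.comp_aemeasurable hv.aemeasurable).min
    aemeasurable_const) (fun x => ?_) fun x y => ?_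
  · rw [abs_of_nonneg (by positivity)]
    linarith [min_le_left |v x| (n : ℝ), abs_nonneg (v x)]
  · have h1 := abs_min_sub_min_le_max |v x| (n : ℝ) |v y| n
    rw [sub_self, abs_zero, max_eq_left (abs_nonneg _)] at h1
    linarith [abs_abs_sub_abs_le (v x) (v y), abs_nonneg (v x - v y)]

lemma tendsto_min_abs (c : ℝ) : Tendsto (fun n : ℕ => min |c| (n : ℝ)) atTop (𝓝 |c|) := by
  obtain ⟨n₀, hn₀⟩ := exists_nat_ge |c|
  refine tendsto_const_nhds.congr' ?_
  filter_upwards [eventually_ge_atTop n₀] with n hn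
  exact (min_eq_left (hn₀.trans (by exact_mod_cast hn))).symm

/-- The minimiser solves the truncated problem against every nonnegative test function. The Choquard
term is nonnegative, so its integrability against unbounded test functions comes out of the
equation for their truncations, by Fatou's lemma. -/
theorem EnergyMinimizer.equation (P : TruncatedProblem Ω s p α r g H a b)
    (M : EnergyMinimizer Ω s p α r g H a b u) (hv : MemW0Pos Ω s p v) :
    ChoquardIntegrable Ω α r u u v ∧
      fracPLap s p u v = (∫ x in Ω, g x (u x) * v x) - choquard Ω α r u u v := by
  have hp := P.one_lt_p
  have hum := M.memW0.aemeasurable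
  let V : ℕ → RN N → ℝ := fun n x => min |v x| n
  have hV : ∀ n, MemW0 Ω s p (V n) := fun n => hv.1.min_abs hp n
  have hV0 : ∀ n x, 0 ≤ V n x := fun n x => le_min (abs_nonneg _) (Nat.cast_nonneg n)
  have hVle : ∀ n x, V n x ≤ |v x| := fun n x => min_le_left _ _
  have heqn : ∀ n, choquard Ω α r u u (V n) =
      (∫ x in Ω, g x (u x) * V n x) - fracPLap s p u (V n) := fun n => by
    have h1 := M.super P (hV n) (hV0 n) (C := n) fun x => min_le_right _ _
    have h2 := M.sub P (hV n) (hV0 n) (C := n) fun x => min_le_right _ _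
    linarith
  have hVlim : ∀ᵐ x ∂(volume : Measure (RN N)), Tendsto (fun n => V n x) atTop (𝓝 (v x)) := by
    filter_upwards [hv.2] with x hx
    have h := tendsto_min_abs (v x)
    simp only [V]
    rwa [abs_of_nonneg hx] at h ⊢
  have hlap : Tendsto (fun n => fracPLap s p u (V n)) atTop (𝓝 (fracPLap s p u v)) := by
    refine tendsto_integral_of_dominated_convergence _
      (fun n => (integrable_fracPLap hp M.memW0 (hV n)).aestronglyMeasurable)
      (integrable_fracPLap hp M.memW0 hv.1).norm (fun n => ae_of_all _ fun z => ?_) ?_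
    · rw [norm_div, norm_div, norm_mul, norm_mul]
      gcongr
      rw [Real.norm_eq_abs, Real.norm_eq_abs]
      have h1 := abs_min_sub_min_le_max |v z.1| (n : ℝ) |v z.2| n
      rw [sub_self, abs_zero, max_eq_left (abs_nonneg _)] at h1
      exact h1.trans (abs_abs_sub_abs_le _ _)
    · filter_upwards [ae_prod_of_ae hVlim] with z hz
      exact ((hz.1.sub hz.2).const_mul _).div_const _
  have hreac : Tendsto (fun n => ∫ x in Ω, g x (u x) * V n x) atTop
      (𝓝 (∫ x in Ω, g x (u x) * v x)) := by
    refine tendsto_integral_of_dominated_convergence _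
      (fun n => (P.integrableOn_reaction hum (hV n)).aestronglyMeasurable)
      (P.integrableOn_reaction hum hv.1).norm (fun n => ae_of_all _ fun x => ?_) ?_
    · rw [norm_mul, norm_mul]
      gcongr
      rw [Real.norm_of_nonneg (hV0 n x)]
      exact hVle n x
    · filter_upwards [ae_restrict_of_ae hVlim] with x hx
      exact hx.const_mul _
  have hcV : ∀ n, ChoquardIntegrable Ω α r u u (V n) := fun n =>
    M.choquardIntegrable P (hV n).aemeasurable (C := n) fun x => by
      rw [abs_of_nonneg (hV0 n x)]; exact min_le_right _ _
  have hclim : ∀ᵐ z ∂((volume : Measure (RN N × RN N)).restrict (Ω ×ˢ Ω)),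
      Tendsto (fun n => choquardIntegrand α r u u (V n) z) atTop
        (𝓝 (choquardIntegrand α r u u v z)) := by
    filter_upwards [ae_restrict_of_ae (ae_prod_of_ae hVlim)] with z hz
    exact (hz.1.const_mul _).div_const _
  have hcnn : ∀ n z, 0 ≤ choquardIntegrand α r u u (V n) z := fun n z =>
    choquardIntegrand_nonneg P.one_lt_r (M.nonneg P _) (hV0 n _)
  have hch := hreac.sub hlap
  simp_rw [← heqn] at hch
  have hmeas := (aemeasurable_choquardIntegrand (α := α) (r := r) hum hum
    hv.1.aemeasurable).restrict (s := Ω ×ˢ Ω)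
  have hci : ChoquardIntegrable Ω α r u u v := by
    refine ⟨hmeas.aestronglyMeasurable, ?_⟩
    rw [hasFiniteIntegral_iff_enorm]
    calc ∫⁻ z in Ω ×ˢ Ω, ‖choquardIntegrand α r u u v z‖ₑ
        ≤ ∫⁻ z in Ω ×ˢ Ω, liminf (fun n => ‖choquardIntegrand α r u u (V n) z‖ₑ) atTop := by
          refine lintegral_mono_ae ?_
          filter_upwards [hclim] with z hz
          exact hz.enorm.liminf_eq.ge
      _ ≤ liminf (fun n => ∫⁻ z in Ω ×ˢ Ω, ‖choquardIntegrand α r u u (V n) z‖ₑ) atTop :=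
          lintegral_liminf_le' fun n => (hcV n).aestronglyMeasurable.enorm
      _ = liminf (fun n => ENNReal.ofReal (choquard Ω α r u u (V n))) atTop := by
          congr 1; ext n
          rw [choquard, ofReal_integral_eq_lintegral_ofReal (hcV n) (ae_of_all _ (hcnn n))]
          exact lintegral_congr fun z => Real.enorm_of_nonneg (hcnn n z)
      _ = ENNReal.ofReal _ := (ENNReal.tendsto_ofReal hch).liminf_eq
      _ < ⊤ := ENNReal.ofReal_lt_top
  refine ⟨hci, ?_⟩
  have hch' : Tendsto (fun n => choquard Ω α r u u (V n)) atTop (𝓝 (choquard Ω α r u u v)) := by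
    refine tendsto_integral_of_dominated_convergence _
      (fun n => (hcV n).aestronglyMeasurable) hci.norm (fun n => ae_of_all _ fun z => ?_) hclim
    unfold choquardIntegrand
    rw [norm_div, norm_div, norm_mul, norm_mul _ (v z.1)]
    gcongr
    rw [Real.norm_of_nonneg (hV0 n _)]
    exact hVle n _
  linarith [tendsto_nhds_unique hch hch']

end Solution

/-! ### Invariance under modification on null sets -/

section Congruence

variable {N : ℕ} {Ω : Set (RN N)} {s p α r : ℝ} {a a' u u' v : RN N → ℝ}

lemma MemW0.congr_ae (hu : MemW0 Ω s p u) (h : u =ᵐ[volume] u') : MemW0 Ω s p u' where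
  memLp := hu.memLp.ae_eq h
  gagliardo := by
    refine hu.gagliardo.congr ?_
    filter_upwards [ae_prod_of_ae h] with z hz
    rw [hz.1, hz.2]
  eq_zero := by
    filter_upwards [hu.eq_zero, h] with x h1 h2 hx
    rw [← h2, h1 hx]

lemma fracPLap_congr_ae (h : u =ᵐ[volume] u') : fracPLap s p u v = fracPLap s p u' v := by
  refine integral_congr_ae ?_
  filter_upwards [ae_prod_of_ae h] with z hz
  rw [hz.1, hz.2]

lemma choquardIntegrand_congr_ae (ha : a =ᵐ[volume] a') (h : u =ᵐ[volume] u') :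
    choquardIntegrand α r a u v =ᵐ[volume] choquardIntegrand α r a' u' v := by
  filter_upwards [ae_prod_of_ae ha, ae_prod_of_ae h] with z h1 h2
  unfold choquardIntegrand
  rw [h1.2, h2.1]

end Congruence

end LogisticChoquard

end

theorem theorem2p9 (N : ℕ) (hN : 2 ≤ N) (Ω : Set (LogisticChoquard.RN N))
    (hΩo : IsOpen Ω) (hΩb : Bornology.IsBounded Ω)
    (s p α : ℝ) (hs0 : 0 < s) (hs1 : s < 1) (hp : 1 < p) (hps : p * s < N)
    (hα0 : 0 < α) (hαN : α < N)
    (r : ℝ) (hr : 1 < r)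
    (f : LogisticChoquard.RN N → ℝ → ℝ) (hf : LogisticChoquard.Caratheodory Ω f)
    (uU uL : LogisticChoquard.RN N → ℝ)
    (hU : LogisticChoquard.StrongSupersolution Ω s p f uU)
    (hL : LogisticChoquard.UniformSubsolution Ω s p α r f uU uL)
    (hLU : ∀ᵐ x ∂(volume.restrict Ω), 0 ≤ uL x ∧ uL x ≤ uU x)
    (hfint : LogisticChoquard.ReactionIntegrable Ω s p f uL uU) :
    ∃ u : LogisticChoquard.RN N → ℝ,
      LogisticChoquard.WeakSolution Ω s p α r f u ∧
      (∀ᵐ x ∂(volume : Measure (LogisticChoquard.RN N)), 0 ≤ u x) ∧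
      (∀ᵐ x ∂(volume.restrict Ω), uL x ≤ u x ∧ u x ≤ uU x) := by
  open LogisticChoquard in
  have hΩm := hΩo.measurableSet
  -- Measurable representatives of the barriers, ordered everywhere.
  have hord : ∀ᵐ x ∂(volume : Measure (RN N)), 0 ≤ uL x ∧ uL x ≤ uU x := by
    filter_upwards [(ae_restrict_iff' hΩm).1 hLU, hL.memW0.eq_zero, hU.memW0.eq_zero]
      with x h1 h2 h3
    by_cases hx : x ∈ Ω
    · exact h1 hx
    · rw [h2 hx, h3 hx]; exact ⟨le_rfl, le_rfl⟩
  have hLm := hL.memW0.aemeasurable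
  have hUm := hU.memW0.aemeasurable
  let a : RN N → ℝ := fun x => max 0 (hLm.mk uL x)
  let b : RN N → ℝ := fun x => max (a x) (hUm.mk uU x)
  have ham : Measurable a := measurable_const.max hLm.measurable_mk
  have hbm : Measurable b := ham.max hUm.measurable_mk
  have h0a : ∀ x, 0 ≤ a x := fun x => le_max_left _ _
  have hab : ∀ x, a x ≤ b x := fun x => le_max_left _ _
  have haL : uL =ᵐ[volume] a := by
    filter_upwards [hLm.ae_eq_mk, hord] with x h1 h2
    simp only [a]
    rw [← h1, max_eq_right h2.1]
  have hbU : uU =ᵐ[volume] b := by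
    filter_upwards [hUm.ae_eq_mk, hord, haL] with x h1 h2 h3
    simp only [b]
    rw [← h1, ← h3, max_eq_right h2.2]
  have haLΩ := ae_restrict_of_ae (s := Ω) haL
  have hbUΩ := ae_restrict_of_ae (s := Ω) hbU
  -- The truncated reaction and its dominating weight.
  obtain ⟨f', hf'm, hf'c, hf'⟩ := exists_measurable_version hf
  obtain ⟨w, hwm, hwab, hwmax⟩ := exists_measurable_half_max hf'm hf'c ham hbm hab
  let c : ℝ → RN N → ℝ := fun t x => max (a x) (min t (b x))
  let g : RN N → ℝ → ℝ := fun x t => f' x (c t x)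
  let H : RN N → ℝ := fun x => 2 * |f' x (w x)|
  have hjoint : Measurable (Function.uncurry fun t x => f' x t) :=
    measurable_uncurry_caratheodory hf'm hf'c
  have hgf : ∀ u : RN N → ℝ, (∀ᵐ x ∂(volume.restrict Ω), a x ≤ u x ∧ u x ≤ b x) →
      ∀ v : RN N → ℝ, (fun x => f x (u x) * v x) =ᵐ[volume.restrict Ω]
        fun x => g x (u x) * v x := by
    intro u hu v
    filter_upwards [hu, hf'] with x h1 h2
    simp only [g, c]
    rw [min_eq_left h1.2, max_eq_right h1.1, h2]
  have hHint : ∀ v, MemW0 Ω s p v → IntegrableOn (fun x => H x * v x) Ω volume := by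
    intro v hv
    have h1 : IntegrableOn (fun x => f x (w x) * v x) Ω volume := by
      refine hfint w hwm.aemeasurable ?_ v hv
      filter_upwards [haLΩ, hbUΩ] with x h1 h2
      rw [h1, h2]; exact hwab x
    refine (h1.const_mul 2).mono (((measurable_norm.comp
      (hjoint.comp (hwm.prodMk measurable_id))).const_mul 2).aemeasurable.mul
      hv.aemeasurable.restrict).aestronglyMeasurable ?_
    filter_upwards [hf'] with x hx
    simp only [H]
    rw [norm_mul, norm_mul, norm_mul, norm_mul, hx, Real.norm_eq_abs |_|, abs_abs, mul_assoc,
      Real.norm_eq_abs (f x (w x))]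
  have P : TruncatedProblem Ω s p α r g H a b :=
    { two_le := hN
      bounded := hΩb
      measurableSet := hΩm
      s_pos := hs0
      one_lt_p := hp
      α_pos := hα0
      α_lt := hαN
      one_lt_r := hr
      measurable_g := fun t =>
        hjoint.comp ((ham.max (measurable_const.min hbm)).prodMk measurable_id)
      continuous_g := fun x =>
        (hf'c x).comp (continuous_const.max (continuous_id.min continuous_const))
      measurable_H := (measurable_norm.comp
        (hjoint.comp (hwm.prodMk measurable_id))).const_mul 2
      abs_g_le := fun x t =>
        hwmax x _ (le_max_left _ _) (max_le (hab x) (min_le_right _ _))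
      integrable_H := hHint
      measurable_b := hbm
      nonneg := h0a
      le := hab
      memW0_a := hL.memW0.congr_ae haL
      memW0_b := hU.memW0.congr_ae hbU
      super := fun v hv => by
        have h := (hU.ineq v hv).2
        rw [fracPLap_congr_ae hbU] at h
        refine le_trans (le_of_eq (integral_congr_ae ?_)) h
        refine (hgf b (ae_of_all _ fun x => ⟨hab x, le_rfl⟩) v).symm.trans ?_
        filter_upwards [hbUΩ] with x hx
        rw [hx]
      sub := fun v hv => by
        obtain ⟨-, h1, h2⟩ := hL.ineq v hv
        have hcong := ae_restrict_of_ae (s := Ω ×ˢ Ω)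
          (choquardIntegrand_congr_ae (α := α) (r := r) (v := v) hbU haL)
        refine ⟨h1.congr hcong, ?_⟩
        have h3 : choquard Ω α r uU uL v = choquard Ω α r b a v := integral_congr_ae hcong
        have h4 : ∫ x in Ω, f x (uL x) * v x = ∫ x in Ω, g x (a x) * v x := by
          refine integral_congr_ae (Filter.EventuallyEq.trans ?_
            (hgf a (ae_of_all _ fun x => ⟨le_rfl, hab x⟩) v))
          filter_upwards [haLΩ] with x hx
          rw [hx]
        rwa [fracPLap_congr_ae haL, h3, h4] at h2 }
  obtain ⟨u, M⟩ := P.exists_minimizer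
  have heq := fun v => hgf u (ae_of_all _ M.mem) v
  have hreac : ∀ v, MemW0Pos Ω s p v → IntegrableOn (fun x => f x (u x) * v x) Ω volume :=
    fun v hv => (P.integrableOn_reaction M.memW0.aemeasurable hv.1).congr (heq v).symm
  have hsol : ∀ v, MemW0Pos Ω s p v → fracPLap s p u v =
      (∫ x in Ω, f x (u x) * v x) - choquard Ω α r u u v := fun v hv => by
    rw [integral_congr_ae (heq v)]
    exact (M.equation P hv).2
  refine ⟨u, ⟨⟨M.memW0, ?_, fun v hv => ⟨hreac v hv, (M.equation P hv).1, (hsol v hv).ge⟩⟩,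
    ⟨M.memW0, ?_, fun v hv => ⟨hreac v hv, (M.equation P hv).1, (hsol v hv).le⟩⟩⟩,
    ae_of_all _ (M.nonneg P), ?_⟩
  · filter_upwards [M.memW0.eq_zero] with x hx h using (hx h).ge
  · filter_upwards [M.memW0.eq_zero] with x hx h using (hx h).le
  · filter_upwards [haLΩ, hbUΩ] with x h1 h2
    rw [h1, h2]
    exact M.mem x
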